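/- A *simplicial real tree* is a simplicial tree $X$ (in the sense of Serre) endowed with a distance $d$ for which the image of every injective path is isometric to a real segment; the edges need not all have the same length. Let $\mathrm{Isom}(X)$ be the group of bijective isometries of $X$ sending vertices to vertices and edges to edges, with the topology for which the pointwise stabilizers of compact subsets of $X$ form a basis of neighbourhoods of the identity. For an isometry $g$, let $\lambda(g)=\inf_{x\in X} d(x,g\cdot x)$ be its translation length. **Theorem.** Let $X$ and $X'$ be two simplicial real trees all of whose vertices have valence $\geq 2$, with $X$ locally finite, and let $\Gamma_0$ be a discrete torsion-free subgroup of $\mathrm{Isom}(X)$ such that the quotient graph $\Gamma_0\backslash X$ is finite. Let $N$ be the number of vertices of $\Gamma_0\backslash X$ and let $\ell>0$ be the maximal length of an edge of $X$. Fix points $x_0\in X$ and $x'_0\in X'$. For a group homomorphism $\rho:\Gamma_0\to\mathrm{Isom}(X')$, let $C_\rho\geq 0$ be the infimum of the real numbers $t\geq 0$ for which there exists $t'\geq 0$ such that $d(x'_0,\rho(\gamma)\cdot x'_0)\leq t\,d(x_0,\gamma\cdot x_0)+t'$ for all $\gamma\in\Gamma_0$ (such $t$ exist). Then $\lambda(\gamma)>0$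 for all $\gamma\in\Gamma_0\smallsetminus\{1\}$, and: 1. The set $F$ of all $\gamma\in\Gamma_0\smallsetminus\{1\}$ with $d(x_0,\gamma\cdot x_0)\leq 4N\ell$ is finite, and for every homomorphism $\rho:\Gamma_0\to\mathrm{Isom}(X')$ one has $$C_\rho\;=\;\sup_{\gamma\in\Gamma_0\smallsetminus\{1\}}\frac{\lambda(\rho(\gamma))}{\lambda(\gamma)}\;=\;\max_{\gamma\in F}\frac{\lambda(\rho(\gamma))}{\lambda(\gamma)}.$$ 2. A homomorphism $\rho:\Gamma_0\to\mathrm{Isom}(X')$ is admissible, i.e. for every $R>0$ one has $d(x'_0,\rho(\gamma)\cdot x'_0)\leq d(x_0,\gamma\cdot x_0)-R$ for all but finitely many $\gamma\in\Gamma_0$, if and only if $C_\rho<1$. -/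

import Mathlib

/-- The metric segment between two points. -/
def metricSegment {X : Type*} [MetricSpace X] (u v : X) : Set X :=
  {x | dist u x + dist x v = dist u v}

/-- A simplicial real tree: a simplicial tree (vertices, edges) realized on the set `X`, with a
distance for which the image of every injective path is isometric to a real segment. Edges may have
different lengths, and infinitely many edges may meet at a vertex. -/
structure SimplicialRTree (X : Type*) [MetricSpace X] where
  /-- the set of vertices -/
  verts : Set X
  /-- the underlying combinatorial tree -/
  graph : SimpleGraph verts
  isTree : graph.IsTree
  /-- the closed edge joining two adjacent vertices is a real segment -/
  edge_isometric : ∀ u v : verts, graph.Adj u v →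
    Nonempty (metricSegment (u : X) v ≃ᵢ Set.Icc (0 : ℝ) (dist (u : X) v))
  /-- `X` is the union of its vertices and its edges -/
  cover : ∀ x : X, x ∈ verts ∨ ∃ u v : verts, graph.Adj u v ∧ x ∈ metricSegment (u : X) v
  /-- the only vertices on an edge are its endpoints -/
  vertex_of_mem_edge : ∀ u v w : verts, graph.Adj u v → (w : X) ∈ metricSegment (u : X) v →
    w = u ∨ w = v
  /-- two distinct edges can meet only at vertices -/
  edge_inter : ∀ u v u' v' : verts, graph.Adj u v → graph.Adj u' v' → s(u, v) ≠ s(u', v') →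
    metricSegment (u : X) v ∩ metricSegment (u' : X) v' ⊆ verts
  /-- the image of every injective path is isometric to a real segment -/
  path_isometric : ∀ f : unitInterval → X, Continuous f → Function.Injective f →
    ∃ L : ℝ, Nonempty (Set.range f ≃ᵢ Set.Icc (0 : ℝ) L)

namespace SimplicialRTree

variable {X : Type*} [MetricSpace X]

/-- The (closed) edges, as subsets of `X`. -/
def edges (T : SimplicialRTree X) : Set (Set X) :=
  {e | ∃ u v : T.verts, T.graph.Adj u v ∧ e = metricSegment (u : X) v}

/-- All vertices have valence at least two. -/
def ValenceGETwo (T : SimplicialRTree X) : Prop :=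
  ∀ v : T.verts, 2 ≤ (T.graph.neighborSet v).encard

/-- All vertices have finite valence. -/
def IsLocallyFinite (T : SimplicialRTree X) : Prop :=
  ∀ v : T.verts, (T.graph.neighborSet v).Finite

/-- The supremum of the edge lengths (a maximum when a group of automorphisms has finite
quotient). -/
noncomputable def maxEdgeLength (T : SimplicialRTree X) : ℝ :=
  sSup {r | ∃ u v : T.verts, T.graph.Adj u v ∧ r = dist (u : X) v}

/-- The group of bijective isometries that send vertices to vertices and edges to edges. -/
def Isom (T : SimplicialRTree X) : Subgroup (X ≃ᵢ X) where
  carrier := {g | (∀ x, g x ∈ T.verts ↔ x ∈ T.verts) ∧ ∀ e : Set X, g '' e ∈ T.edges ↔ e ∈ T.edges}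
  one_mem' := by
    refine ⟨fun x => Iff.rfl, fun e => ?_⟩
    have : (1 : X ≃ᵢ X) '' e = e := Set.image_id e
    rw [this]
  mul_mem' := by
    rintro g h ⟨hg, hg'⟩ ⟨hh, hh'⟩
    refine ⟨fun x => (hg (h x)).trans (hh x), fun e => ?_⟩
    have : (g * h) '' e = g '' (h '' e) := Set.image_comp g h e
    rw [this, hg', hh']
  inv_mem' := by
    rintro g ⟨hg, hg'⟩
    refine ⟨fun x => ?_, fun e => ?_⟩
    · have := hg (g⁻¹ x)
      rw [← this, IsometryEquiv.apply_inv_self]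
    · rw [← hg', ← Set.image_comp]
      have : (⇑g ∘ ⇑g⁻¹) = id := by
        funext x
        exact IsometryEquiv.apply_inv_self g x
      rw [this, Set.image_id]

/-- The topology on the isometry group whose basic open sets are the left translates of the
pointwise stabilizers of compact subsets of `X`. -/
instance (T : SimplicialRTree X) : TopologicalSpace T.Isom :=
  TopologicalSpace.generateFrom
    {U | ∃ (g : T.Isom) (K : Set X), IsCompact K ∧
      U = {h : T.Isom | ∀ x ∈ K, (h : X ≃ᵢ X) x = (g : X ≃ᵢ X) x}}

/-- The vertices of the quotient graph: orbits of vertices. -/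
def quotientVerts (T : SimplicialRTree X) (Γ : Subgroup T.Isom) : Set (Set X) :=
  {O | ∃ v ∈ T.verts, O = {x | ∃ γ : Γ, x = ((γ : T.Isom) : X ≃ᵢ X) v}}

/-- The edges of the quotient graph: orbits of edges. -/
def quotientEdges (T : SimplicialRTree X) (Γ : Subgroup T.Isom) : Set (Set (Set X)) :=
  {O | ∃ e ∈ T.edges, O = {e' | ∃ γ : Γ, e' = ((γ : T.Isom) : X ≃ᵢ X) '' e}}

end SimplicialRTree

/-- The translation length of an isometry. -/
noncomputable def translationLength {X : Type*} [MetricSpace X] (g : X ≃ᵢ X) : ℝ :=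
  ⨅ x : X, dist x (g x)

namespace SimplicialRTree

variable {X X' : Type*} [MetricSpace X] [MetricSpace X'] {T : SimplicialRTree X}
  {T' : SimplicialRTree X'}

/-- The set of `t ≥ 0` for which there is `t' ≥ 0` such that
`d(x₀', ρ(γ) x₀') ≤ t d(x₀, γ x₀) + t'` for all `γ`. -/
def growthSet (Γ : Subgroup T.Isom) (ρ : Γ →* T'.Isom) (x₀ : X) (x₀' : X') : Set ℝ :=
  {t | 0 ≤ t ∧ ∃ t' : ℝ, 0 ≤ t' ∧ ∀ γ : Γ,
    dist x₀' ((ρ γ : X' ≃ᵢ X') x₀') ≤ t * dist x₀ (((γ : T.Isom) : X ≃ᵢ X) x₀) + t'}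

/-- The growth constant `C_ρ`. -/
noncomputable def growthConst (Γ : Subgroup T.Isom) (ρ : Γ →* T'.Isom) (x₀ : X) (x₀' : X') : ℝ :=
  sInf (growthSet Γ ρ x₀ x₀')

/-- `ρ` is admissible: for every `R > 0`, one has `d(x₀', ρ(γ) x₀') ≤ d(x₀, γ x₀) - R` for all but
finitely many `γ`. -/
def Admissible (Γ : Subgroup T.Isom) (ρ : Γ →* T'.Isom) (x₀ : X) (x₀' : X') : Prop :=
  ∀ R : ℝ, 0 < R → ∀ᶠ γ : Γ in Filter.cofinite,
    dist x₀' ((ρ γ : X' ≃ᵢ X') x₀') ≤ dist x₀ (((γ : T.Isom) : X ≃ᵢ X) x₀) - R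

/-- The quotient `λ(ρ(γ)) / λ(γ)` of translation lengths. -/
noncomputable def lengthRatio (Γ : Subgroup T.Isom) (ρ : Γ →* T'.Isom) (γ : Γ) : ℝ :=
  translationLength (ρ γ : X' ≃ᵢ X') / translationLength ((γ : T.Isom) : X ≃ᵢ X)

/-- The set of `γ ≠ 1` with `d(x₀, γ x₀) ≤ 4 N ℓ`, where `N` is the number of vertices of the
quotient graph and `ℓ` is the maximal edge length. -/
def shortElements (Γ : Subgroup T.Isom) (x₀ : X) : Set Γ :=
  {γ | γ ≠ 1 ∧ dist x₀ (((γ : T.Isom) : X ≃ᵢ X) x₀) ≤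
    4 * ((T.quotientVerts Γ).ncard : ℝ) * T.maxEdgeLength}

end SimplicialRTree

/-!
Both statements reduce to facts about isometries of real trees, that is, of geodesic spaces with the
four-point condition. A simplicial real tree is one (`SimplicialRTree.isRealTree`): two geodesic
arcs meeting only at a common endpoint form an injective path, hence by assumption a geodesic arc;
so "being joined by a geodesic arc" is transitive, and points have gates in arcs, which gives the
four-point condition.

In a real tree the translation length is attained and satisfies `n λ(g) ≤ d(x, gⁿ x)`. The main tool
is `IsRealTree.exists_forall_dist_le`: if `λ(gᵢ) ≤ cᵢ`, and `λ(gᵢ gⱼ) ≤ cᵢ + cⱼ` for `i ≠ j`, for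
finitely many isometries, then a single point is moved by at most `cᵢ` by every `gᵢ`. The sets of points moved by
at most `cᵢ` are convex, so by Helly's theorem it suffices that they meet in pairs. If two of them
do not meet, then a point `q` of a segment joining them lies in neither; `gᵢ` and `gⱼ` move `q` in
opposite directions, so `λ(gᵢ gⱼ) ≥ d(q, gᵢ q) + d(q, gⱼ q) > cᵢ + cⱼ`.

Let `M` be the maximum of the ratios `λ(ρ(γ)) / λ(γ)` over the short elements. The tool is used
twice.

* `λ(ρ(γ)) ≤ M d(p, γ p)` for all vertices `p`, by induction on the right-hand side
  (`IsFreeCocompact.translationLength_le_mul_dist`). If the path from `p` to `γ p` has at most `2 N`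
  edges, then `γ` is conjugate to a short element, as the quotient graph has diameter at most
  `(N - 1) ℓ`. Otherwise the path visits an orbit three times and, up to conjugation, `γ` is a
  product of three elements whose displacements add up to that of `γ`; the induction hypothesis
  applies to them and to their products in pairs. Passing to powers, `λ(ρ(γ)) ≤ M λ(γ)`.
* For every `R` some point `y` satisfies `d(y, ρ(γ) y) ≤ M d(x₀, γ x₀)` for all the finitely many
  `γ` with `d(x₀, γ x₀) ≤ R`. Cutting geodesics into pieces of length about `R`, the growth constant
  is at most `M (1 + O(1 / R))` (`IsFreeCocompact.exists_growth_bound`), hence at most `M`.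

Conversely the powers of `γ` show that the growth constant is at least `λ(ρ(γ)) / λ(γ)`. If it is
smaller than `1`, admissibility follows from the properness of the action; if `ρ` is admissible, the
powers of a `γ` realizing the maximum show that this maximum is smaller than `1`.
-/

/-! ### Real trees and isometries -/

/-- `φ` restricts to an isometric embedding of `[0, d(x, y)]` that goes from `x` to `y`. -/
def IsGeodArc {X : Type*} [MetricSpace X] (φ : ℝ → X) (x y : X) : Prop :=
  φ 0 = x ∧ φ (dist x y) = y ∧
    ∀ s ∈ Set.Icc 0 (dist x y), ∀ t ∈ Set.Icc 0 (dist x y), dist (φ s) (φ t) = |s - t|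

/-- A metric space is a *real tree* if any two points are joined by an arc isometric to a real
segment, and the four-point condition holds. -/
structure IsRealTree (X : Type*) [MetricSpace X] : Prop where
  exists_arc : ∀ x y : X, ∃ φ : ℝ → X, IsGeodArc φ x y
  four_point : ∀ x y z w : X,
    dist x y + dist z w ≤ max (dist x z + dist y w) (dist x w + dist y z)

theorem IsGeodArc.continuousOn {X : Type*} [MetricSpace X] {φ : ℝ → X} {x y : X}
    (h : IsGeodArc φ x y) : ContinuousOn φ (Set.Icc 0 (dist x y)) := by
  rw [Metric.continuousOn_iff]
  exact fun t ht ε hε => ⟨ε, hε, fun s hs hst => by rwa [h.2.2 s hs t ht]⟩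

/-- A set is geodesically convex if it contains the metric segment between any two of its points. -/
def IsGeodConvex {X : Type*} [MetricSpace X] (A : Set X) : Prop :=
  ∀ y ∈ A, ∀ z ∈ A, metricSegment y z ⊆ A

theorem IsGeodConvex.inter {X : Type*} [MetricSpace X] {A B : Set X} (hA : IsGeodConvex A)
    (hB : IsGeodConvex B) : IsGeodConvex (A ∩ B) :=
  fun y hy z hz _ hw => ⟨hA y hy.1 z hz.1 hw, hB y hy.2 z hz.2 hw⟩

/-- The points moved by at most `c`. -/
def displacementSet {X : Type*} [MetricSpace X] (g : X ≃ᵢ X) (c : ℝ) : Set X :=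
  {y | dist y (g y) ≤ c}

theorem le_of_forall_nat_mul_le {a b c : ℝ} (h : ∀ n : ℕ, n * a ≤ n * b + c) : a ≤ b := by
  by_contra! hab
  obtain ⟨n, hn⟩ := exists_nat_gt (c / (a - b))
  rw [div_lt_iff₀ (by linarith)] at hn
  linarith [h n]

section Displacement

variable {X : Type*} [MetricSpace X]

theorem translationLength_le (g : X ≃ᵢ X) (x : X) : translationLength g ≤ dist x (g x) :=
  ciInf_le ⟨0, by rintro _ ⟨y, rfl⟩; exact dist_nonneg⟩ x

theorem translationLength_nonneg (g : X ≃ᵢ X) : 0 ≤ translationLength g :=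
  Real.iInf_nonneg fun _ => dist_nonneg

theorem translationLength_one [Nonempty X] : translationLength (1 : X ≃ᵢ X) = 0 := by
  obtain ⟨x⟩ := ‹Nonempty X›
  refine le_antisymm ?_ (translationLength_nonneg _)
  simpa using translationLength_le (1 : X ≃ᵢ X) x

theorem translationLength_conj_le (g h : X ≃ᵢ X) (x : X) :
    translationLength (h * g * h⁻¹) ≤ dist x (g x) := by
  refine (translationLength_le _ (h x)).trans_eq ?_
  simp [IsometryEquiv.mul_apply, h.dist_eq]

theorem translationLength_conj (g h : X ≃ᵢ X) :
    translationLength (h * g * h⁻¹) = translationLength g := by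
  rcases isEmpty_or_nonempty X with hX | hX
  · simp [translationLength]
  refine le_antisymm (le_ciInf fun x => translationLength_conj_le g h x) (le_ciInf fun x => ?_)
  have := translationLength_conj_le (h * g * h⁻¹) h⁻¹ x
  rwa [show h⁻¹ * (h * g * h⁻¹) * h⁻¹⁻¹ = g by group] at this

theorem dist_pow_apply_le (g : X ≃ᵢ X) (y : X) (n : ℕ) :
    dist y ((g ^ n) y) ≤ n * dist y (g y) := by
  induction n with
  | zero => simp
  | succ n ih =>
    have h1 : dist ((g ^ n) y) ((g ^ (n + 1)) y) = dist y (g y) := by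
      rw [pow_succ, IsometryEquiv.mul_apply, (g ^ n).dist_eq]
    have := dist_triangle y ((g ^ n) y) ((g ^ (n + 1)) y)
    push_cast
    linarith

theorem dist_pow_apply_le_of_base (g : X ≃ᵢ X) (x y : X) (n : ℕ) :
    dist x ((g ^ n) x) ≤ n * dist y (g y) + 2 * dist x y := by
  have h1 := dist_pow_apply_le g y n
  have h2 : dist ((g ^ n) y) ((g ^ n) x) = dist x y := by rw [(g ^ n).dist_eq, dist_comm]
  have := dist_triangle4 x y ((g ^ n) y) ((g ^ n) x)
  linarith

theorem dist_inv_apply (g : X ≃ᵢ X) (x : X) : dist x (g⁻¹ x) = dist x (g x) := by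
  rw [← g.dist_eq x (g⁻¹ x), IsometryEquiv.apply_inv_self, dist_comm]

end Displacement

/-! ### Translation lengths and displacement sets in real trees -/

namespace IsRealTree

variable {X : Type*} [MetricSpace X] (hX : IsRealTree X)
include hX

theorem exists_dist_eq (x y : X) {t : ℝ} (h0 : 0 ≤ t) (h1 : t ≤ dist x y) :
    ∃ z, dist x z = t ∧ dist z y = dist x y - t := by
  obtain ⟨φ, hφ0, hφ1, hφ⟩ := hX.exists_arc x y
  refine ⟨φ t, ?_, ?_⟩
  · have := hφ 0 ⟨le_rfl, dist_nonneg⟩ t ⟨h0, h1⟩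
    rwa [hφ0, zero_sub, abs_neg, abs_of_nonneg h0] at this
  · have := hφ t ⟨h0, h1⟩ _ ⟨dist_nonneg, le_rfl⟩
    rwa [hφ1, abs_sub_comm, abs_of_nonneg (by linarith)] at this

/-- The midpoint of `x` and `g x` is moved by at most `max 0 (d(x, g² x) - d(x, g x))`. -/
theorem exists_dist_apply_le (g : X ≃ᵢ X) (x : X) :
    ∃ m, dist m (g m) ≤ max 0 (dist x (g (g x)) - dist x (g x)) := by
  obtain ⟨m, h1, h2⟩ := hX.exists_dist_eq x (g x) (t := dist x (g x) / 2)
    (by positivity) (by linarith [dist_nonneg (x := x) (y := g x)])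
  refine ⟨m, ?_⟩
  have a1 : dist (g x) (g (g x)) = dist x (g x) := g.dist_eq _ _
  have a2 : dist (g x) (g m) = dist x m := g.dist_eq _ _
  have a3 : dist (g m) (g (g x)) = dist m (g x) := g.dist_eq _ _
  have b1 := hX.four_point m (g m) x (g x)
  have b2 := hX.four_point (g m) x (g x) (g (g x))
  rw [dist_comm m x, dist_comm (g m) (g x)] at b1
  rw [dist_comm (g m) (g x)] at b2
  rw [le_max_iff] at b1 b2 ⊢
  rcases b1 with b1 | b1
  · left; linarith
  · rcases b2 with b2 | b2
    · right; linarith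
    · left; linarith

/-- If `d(x, g² x) > d(x, g x)`, then the distances `d(x, gⁿ x)` grow by at least
`d(x, g² x) - d(x, g x)` at each step. -/
theorem dist_pow_growth (g : X ≃ᵢ X) (x : X) (h : dist x (g x) < dist x (g (g x))) (n : ℕ) :
    dist x (g x) + n * (dist x (g (g x)) - dist x (g x)) ≤ dist x ((g ^ (n + 1)) x) := by
  have step : ∀ n : ℕ, dist x (g x) ≤ dist x ((g ^ (n + 1)) x) ∧
      dist x ((g ^ (n + 1)) x) + (dist x (g (g x)) - dist x (g x)) ≤ dist x ((g ^ (n + 2)) x) := by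
    intro n
    induction n with
    | zero => simp [pow_two, IsometryEquiv.mul_apply]
    | succ n ih =>
      have h1 : ∀ k : ℕ, dist (g x) ((g ^ (k + 1)) x) = dist x ((g ^ k) x) := by
        intro k
        rw [pow_succ', IsometryEquiv.mul_apply, g.dist_eq]
      have h2 : dist ((g ^ (n + 2)) x) ((g ^ (n + 3)) x) = dist x (g x) := by
        rw [pow_succ g (n + 2), IsometryEquiv.mul_apply, (g ^ (n + 2)).dist_eq]
      have h3 := hX.four_point x ((g ^ (n + 2)) x) (g x) ((g ^ (n + 3)) x)
      rw [h1 (n + 2), h2, dist_comm ((g ^ (n + 2)) x) (g x), h1 (n + 1), le_max_iff] at h3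
      refine ⟨by linarith [ih.1, ih.2], ?_⟩
      rcases h3 with h3 | h3
      · linarith [ih.1, ih.2]
      · linarith [ih.1, ih.2]
  induction n with
  | zero => simp
  | succ n ih =>
    have := (step n).2
    push_cast
    linarith

theorem dist_apply_apply_sub_le (g : X ≃ᵢ X) (x y : X) :
    dist x (g (g x)) - dist x (g x) ≤ dist y (g y) := by
  rcases le_or_gt (dist x (g (g x))) (dist x (g x)) with h | h
  · linarith [dist_nonneg (x := y) (y := g y)]
  refine le_of_forall_nat_mul_le (c := dist y (g y) + 2 * dist x y) fun n => ?_
  have h1 := hX.dist_pow_growth g x h n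
  have h2 := dist_pow_apply_le_of_base g x y (n + 1)
  push_cast at h2
  linarith [dist_nonneg (x := x) (y := g x)]

/-- The infimum defining the translation length is attained. -/
theorem exists_dist_eq_translationLength [Nonempty X] (g : X ≃ᵢ X) :
    ∃ m, dist m (g m) = translationLength g := by
  obtain ⟨x⟩ := ‹Nonempty X›
  obtain ⟨m, hm⟩ := hX.exists_dist_apply_le g x
  refine ⟨m, le_antisymm (le_ciInf fun y => hm.trans ?_) (translationLength_le g m)⟩
  exact max_le dist_nonneg (hX.dist_apply_apply_sub_le g x y)

theorem nat_mul_translationLength_le (g : X ≃ᵢ X) (x : X) (n : ℕ) :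
    n * translationLength g ≤ dist x ((g ^ n) x) := by
  rcases n with _ | n
  · simp
  rcases (translationLength_nonneg g).eq_or_lt with h | h
  · rw [← h]; simp
  obtain ⟨m, hm⟩ := hX.exists_dist_apply_le g x
  have h1 := (translationLength_le g m).trans hm
  have h2 : translationLength g ≤ dist x (g (g x)) - dist x (g x) := by
    rcases le_max_iff.1 h1 with h1 | h1 <;> linarith
  have h3 := hX.dist_pow_growth g x (by linarith) n
  have h4 : (n : ℝ) * translationLength g ≤ n * (dist x (g (g x)) - dist x (g x)) := by gcongr
  push_cast
  linarith [translationLength_le g x]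

theorem isGeodConvex_displacementSet (g : X ≃ᵢ X) (c : ℝ) :
    IsGeodConvex (displacementSet g c) := by
  intro y hy z hz w hw
  simp only [displacementSet, metricSegment, Set.mem_ofPred_eq] at *
  have a1 : dist (g y) (g w) = dist y w := g.dist_eq _ _
  have a2 : dist (g w) (g z) = dist w z := g.dist_eq _ _
  have a3 : dist (g y) (g z) = dist y z := g.dist_eq _ _
  have b1 := hX.four_point w (g w) y z
  have b2 := hX.four_point (g w) z (g y) (g z)
  have b3 := hX.four_point (g w) y (g y) (g z)
  have t1 := dist_triangle z (g z) (g y)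
  have t2 := dist_triangle y (g y) (g z)
  simp only [dist_comm w y, dist_comm (g w) (g y), dist_comm (g z) (g y), dist_comm z (g y),
    dist_comm y (g y), dist_comm y (g z), dist_comm z (g z), dist_comm (g w) z,
    dist_comm (g w) y] at *
  have n1 := dist_nonneg (x := w) (y := z)
  have n2 := dist_nonneg (x := y) (y := w)
  rw [le_max_iff] at b1 b2 b3
  rcases b1 with b1 | b1
  · rcases b2 with b2 | b2 <;> linarith
  · rcases b3 with b3 | b3 <;> linarith

/-- Any three points have a median. -/
theorem exists_median (p q r : X) :
    ∃ m, m ∈ metricSegment p q ∧ m ∈ metricSegment p r ∧ m ∈ metricSegment q r := by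
  have t1 := dist_triangle p q r
  have t2 := dist_triangle q p r
  have t3 := dist_triangle p r q
  rw [dist_comm q p] at t2
  rw [dist_comm r q] at t3
  obtain ⟨m, h1, h2⟩ := hX.exists_dist_eq p q (t := (dist p q + dist p r - dist q r) / 2)
    (by linarith) (by linarith)
  have h3 := hX.four_point m r p q
  rw [dist_comm m p, dist_comm r q, dist_comm r p, le_max_iff] at h3
  have h4 : dist m r ≤ (dist p r + dist q r - dist p q) / 2 := by
    rcases h3 with h3 | h3 <;> linarith
  have s1 := dist_triangle p m r
  have s2 := dist_triangle q m r
  rw [dist_comm q m] at s2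
  refine ⟨m, ?_, ?_, ?_⟩ <;> simp only [metricSegment, Set.mem_ofPred_eq]
  · linarith
  · linarith
  · rw [dist_comm q m]; linarith

/-- Helly's theorem for finite families of convex subsets of a real tree. -/
theorem helly {ι : Type*} (s : Finset ι) (hs : s.Nonempty) (A : ι → Set X)
    (hA : ∀ i ∈ s, IsGeodConvex (A i)) (hp : ∀ i ∈ s, ∀ j ∈ s, (A i ∩ A j).Nonempty) :
    ∃ x, ∀ i ∈ s, x ∈ A i := by
  classical
  induction hs using Finset.Nonempty.cons_induction generalizing A with
  | singleton i =>
    obtain ⟨x, hx⟩ := hp i (by simp) i (by simp)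
    exact ⟨x, by simpa using hx.1⟩
  | cons i s hi hs ih =>
    obtain ⟨x, hx⟩ := ih (fun j => A j ∩ A i)
      (fun j hj => (hA j (by simp [hj])).inter (hA i (by simp))) (fun j hj k hk => by
        obtain ⟨p, hp1, hp2⟩ := hp j (by simp [hj]) k (by simp [hk])
        obtain ⟨q, hq1, hq2⟩ := hp j (by simp [hj]) i (by simp)
        obtain ⟨r, hr1, hr2⟩ := hp k (by simp [hk]) i (by simp)
        obtain ⟨m, hm1, hm2, hm3⟩ := hX.exists_median p q r
        have mj := hA j (by simp [hj]) p hp1 q hq1 hm1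
        have mk := hA k (by simp [hk]) p hp2 r hr1 hm2
        have mi := hA i (by simp) q hq2 r hr2 hm3
        exact ⟨m, ⟨mj, mi⟩, ⟨mk, mi⟩⟩)
    obtain ⟨j, hj⟩ := hs
    refine ⟨x, fun k hk => ?_⟩
    rcases Finset.mem_cons.1 hk with rfl | hk
    · exact (hx j hj).2
    · exact (hx k hk).1

/-- Suppose `q` lies between `y` and `z`, is moved more than `y` by `g` and more than `z` by `h`.
Then `g` moves `q` towards `y` and `h` moves `q` towards `z`, so `q` lies between `g q` and
`h q`. -/
theorem dist_apply_apply_eq_add {g h : X ≃ᵢ X} {y z q : X} (hq : q ∈ metricSegment y z)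
    (hg : dist y (g y) < dist q (g q)) (hh : dist z (h z) < dist q (h q)) :
    dist (g q) (h q) = dist q (g q) + dist q (h q) := by
  have hq' : dist y q + dist q z = dist y z := hq
  refine le_antisymm (by simpa [dist_comm] using dist_triangle (g q) q (h q)) ?_
  by_contra! hlt
  have t1 : dist (g q) y ≤ dist y q + dist y (g y) := by
    have := dist_triangle (g q) (g y) y
    rw [g.dist_eq, dist_comm q y, dist_comm (g y)] at this
    exact this
  have t2 : dist (h q) z ≤ dist q z + dist z (h z) := by
    have := dist_triangle (h q) (h z) z
    rw [h.dist_eq, dist_comm (h z)] at this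
    exact this
  have f1 := hX.four_point (h q) y q (g q)
  have f2 := hX.four_point y z q (h q)
  rw [dist_comm (h q) q, dist_comm y (g q), dist_comm (h q) (g q)] at f1
  rw [dist_comm z (h q), dist_comm z q] at f2
  rw [le_max_iff] at f1 f2
  rw [dist_comm (h q) y] at f1
  rcases f1 with f1 | f1 <;> rcases f2 with f2 | f2 <;> linarith

/-- A path through `a`, `b`, `c`, `d` with `b ≠ c` that turns back neither at `b` nor at `c` is
geodesic. -/
theorem dist_eq_add_of_local {a b c d : X} (h1 : dist a c = dist a b + dist b c)
    (h2 : dist b d = dist b c + dist c d) (hbc : 0 < dist b c) :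
    dist a d = dist a b + dist b c + dist c d := by
  have f := hX.four_point a c b d
  rw [dist_comm c b, le_max_iff] at f
  have t := dist_triangle4 a b c d
  rcases f with f | f <;> linarith

theorem add_le_translationLength_mul {g h : X ≃ᵢ X} {y z q : X} (hq : q ∈ metricSegment y z)
    (hg : dist y (g y) < dist q (g q)) (hh : dist z (h z) < dist q (h q)) :
    dist q (g q) + dist q (h q) ≤ translationLength (g * h) := by
  have hg' : dist y (g⁻¹ y) < dist q (g⁻¹ q) := by rwa [dist_inv_apply, dist_inv_apply]
  have hh' : dist z (h⁻¹ z) < dist q (h⁻¹ q) := by rwa [dist_inv_apply, dist_inv_apply]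
  have e1 := hX.dist_apply_apply_eq_add hq hg' hh
  have e2 := hX.dist_apply_apply_eq_add hq hg hh'
  rw [dist_inv_apply] at e1 e2
  -- the path `q, g q, g h q, g h g q, g h g h q` does not turn back
  have ng : 0 < dist q (g q) := dist_nonneg.trans_lt hg
  have nh : 0 < dist q (h q) := dist_nonneg.trans_lt hh
  have A : dist q (g (h q)) = dist q (g q) + dist q (h q) := by
    rw [← e1, ← g.dist_eq (g⁻¹ q) (h q), IsometryEquiv.apply_inv_self]
  have B : dist (g q) (g (h (g q))) = dist q (g q) + dist q (h q) := by
    rw [g.dist_eq, ← e2, ← h.dist_eq (g q) (h⁻¹ q), IsometryEquiv.apply_inv_self, dist_comm]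
  have C : dist (g (h q)) (g (h (g q))) = dist q (g q) := by rw [g.dist_eq, h.dist_eq]
  have D : dist (g (h (g q))) (g (h (g (h q)))) = dist q (h q) := by
    rw [g.dist_eq, h.dist_eq, g.dist_eq]
  have E : dist (g q) (g (h q)) = dist q (h q) := g.dist_eq _ _
  have F : dist (g (h q)) (g (h (g (h q)))) = dist q (g q) + dist q (h q) := by
    rw [g.dist_eq, h.dist_eq, A]
  have G := hX.dist_eq_add_of_local (a := q) (b := g q) (c := g (h q)) (d := g (h (g q)))
    (by rw [A, E]) (by rw [B, E, C, add_comm]) (by rwa [E])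
  have H := hX.dist_eq_add_of_local (a := q) (b := g (h q)) (c := g (h (g q)))
    (d := g (h (g (h q)))) (by rw [G, A, E]) (by rw [F, C, D]) (by rwa [C])
  have : Nonempty X := ⟨q⟩
  refine le_trans ?_ (le_ciInf fun x => hX.dist_apply_apply_sub_le (g * h) q x)
  simp only [IsometryEquiv.mul_apply]
  linarith

/-- If `λ(g) ≤ a`, `λ(h) ≤ b` and `λ(g h) ≤ a + b`, then some point is moved by at most `a` by `g`
and by at most `b` by `h`. -/
theorem displacementSet_inter_nonempty [Nonempty X] {g h : X ≃ᵢ X} {a b : ℝ}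
    (hg : translationLength g ≤ a) (hh : translationLength h ≤ b)
    (hgh : translationLength (g * h) ≤ a + b) :
    (displacementSet g a ∩ displacementSet h b).Nonempty := by
  obtain ⟨y, hy⟩ := hX.exists_dist_eq_translationLength g
  obtain ⟨z, hz⟩ := hX.exists_dist_eq_translationLength h
  obtain ⟨φ, h0, h1, hφ⟩ := hX.exists_arc y z
  have hcont : ContinuousOn φ (Set.Icc 0 (dist y z)) := IsGeodArc.continuousOn ⟨h0, h1, hφ⟩
  -- the geodesic from `y` to `z` is connected and covered by two closed sets
  have hclosed : ∀ (k : X ≃ᵢ X) (c : ℝ), IsClosed (displacementSet k c) := fun k c =>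
    isClosed_le (continuous_id.dist k.continuous) continuous_const
  have hconn : IsPreconnected (φ '' Set.Icc 0 (dist y z)) := isPreconnected_Icc.image φ hcont
  have hcover : φ '' Set.Icc 0 (dist y z) ⊆ displacementSet g a ∪ displacementSet h b := by
    rintro _ ⟨t, ht, rfl⟩
    by_contra hq
    simp only [displacementSet, Set.mem_union, Set.mem_ofPred_eq, not_or, not_le] at hq
    have hseg : φ t ∈ metricSegment y z := by
      have e1 := hφ 0 ⟨le_rfl, dist_nonneg⟩ t ht
      have e2 := hφ t ht _ ⟨dist_nonneg, le_rfl⟩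
      rw [h0, zero_sub, abs_neg, abs_of_nonneg ht.1] at e1
      rw [h1, abs_sub_comm, abs_of_nonneg (by linarith [ht.2])] at e2
      simp only [metricSegment, Set.mem_ofPred_eq]
      linarith
    have := hX.add_le_translationLength_mul (g := g) (h := h) hseg (by linarith [hq.1]) (by linarith [hq.2])
    linarith [hq.1, hq.2]
  obtain ⟨x, -, hx⟩ := isPreconnected_closed_iff.1 hconn _ _ (hclosed g a) (hclosed h b) hcover
    ⟨y, ⟨0, ⟨le_rfl, dist_nonneg⟩, h0⟩, (hy.trans_le hg : dist y (g y) ≤ a)⟩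
    ⟨z, ⟨dist y z, ⟨dist_nonneg, le_rfl⟩, h1⟩, (hz.trans_le hh : dist z (h z) ≤ b)⟩
  exact ⟨x, hx⟩

/-- Finitely many isometries `g i` with `λ(g i) ≤ c i`, and `λ(g i g j) ≤ c i + c j` for `i ≠ j`,
have a common point moved by at most `c i` by every `g i`. -/
theorem exists_forall_dist_le [Nonempty X] {ι : Type*} (s : Finset ι) (g : ι → X ≃ᵢ X) (c : ι → ℝ)
    (h1 : ∀ i ∈ s, translationLength (g i) ≤ c i)
    (h2 : ∀ i ∈ s, ∀ j ∈ s, i ≠ j → translationLength (g i * g j) ≤ c i + c j) :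
    ∃ y, ∀ i ∈ s, dist y (g i y) ≤ c i := by
  rcases s.eq_empty_or_nonempty with rfl | hs
  · exact ⟨Classical.arbitrary X, by simp⟩
  refine hX.helly s hs (fun i => displacementSet (g i) (c i))
    (fun i _ => hX.isGeodConvex_displacementSet _ _) fun i hi j hj => ?_
  by_cases hij : i = j
  · subst hij
    obtain ⟨m, hm⟩ := hX.exists_dist_eq_translationLength (g i)
    have : m ∈ displacementSet (g i) (c i) := hm.trans_le (h1 i hi)
    exact ⟨m, this, this⟩
  · exact hX.displacementSet_inter_nonempty (h1 i hi) (h1 j hj) (h2 i hi j hj hij)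

end IsRealTree

/-! ### Spaces in which arcs are isometric to segments -/

/-- The image of every injective path is isometric to a real segment. -/
def ArcsAreSegments (X : Type*) [MetricSpace X] : Prop :=
  ∀ f : unitInterval → X, Continuous f → Function.Injective f →
    ∃ L : ℝ, Nonempty (Set.range f ≃ᵢ Set.Icc (0 : ℝ) L)

section Arcs

variable {X : Type*} [MetricSpace X]

/-- A sub-arc of a geodesic arc, possibly traversed backwards. -/
theorem IsGeodArc.exists_subarc {φ : ℝ → X} {x y : X} (h : IsGeodArc φ x y) {s t : ℝ}
    (hs : s ∈ Set.Icc 0 (dist x y)) (ht : t ∈ Set.Icc 0 (dist x y)) :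
    ∃ χ, IsGeodArc χ (φ s) (φ t) ∧
      ∀ u ∈ Set.Icc 0 |s - t|, ∃ v ∈ Set.Icc 0 (dist x y), χ u = φ v ∧ |s - v| = u := by
  have hd := h.2.2 s hs t ht
  rcases le_total s t with hst | hst
  · have e : |s - t| = t - s := by rw [abs_sub_comm, abs_of_nonneg (by linarith)]
    rw [e] at hd
    have key : ∀ u ∈ Set.Icc 0 (t - s), s + u ∈ Set.Icc 0 (dist x y) := fun u hu =>
      ⟨by linarith [hs.1, hu.1], by linarith [ht.2, hu.2]⟩
    refine ⟨fun u => φ (s + u), ⟨by simp, by simp [hd], fun u hu v hv => ?_⟩, fun u hu => ?_⟩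
    · rw [hd] at hu hv
      rw [h.2.2 _ (key u hu) _ (key v hv)]
      congr 1; ring
    · rw [e] at hu
      refine ⟨s + u, key u hu, rfl, ?_⟩
      rw [abs_sub_comm, add_sub_cancel_left, abs_of_nonneg hu.1]
  · have e : |s - t| = s - t := abs_of_nonneg (by linarith)
    rw [e] at hd
    have key : ∀ u ∈ Set.Icc 0 (s - t), s - u ∈ Set.Icc 0 (dist x y) := fun u hu =>
      ⟨by linarith [ht.1, hu.2], by linarith [hs.2, hu.1]⟩
    refine ⟨fun u => φ (s - u), ⟨by simp, by simp [hd], fun u hu v hv => ?_⟩, fun u hu => ?_⟩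
    · rw [hd] at hu hv
      rw [h.2.2 _ (key u hu) _ (key v hv), abs_sub_comm]
      congr 1; ring
    · rw [e] at hu
      refine ⟨s - u, key u hu, rfl, ?_⟩
      rw [sub_sub_cancel, abs_of_nonneg hu.1]

theorem IsGeodArc.exists_symm {φ : ℝ → X} {x y : X} (h : IsGeodArc φ x y) :
    ∃ χ, IsGeodArc χ y x := by
  obtain ⟨χ, hχ, -⟩ := h.exists_subarc ⟨dist_nonneg, le_rfl⟩ ⟨le_rfl, dist_nonneg⟩
  rw [h.1, h.2.1] at hχ
  exact ⟨χ, hχ⟩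

/-- Distances add up along an injective path: read in the segment isometric to its image, the path
is a strictly monotone function. -/
theorem ArcsAreSegments.dist_eq_add (hp : ArcsAreSegments X) {f : unitInterval → X}
    (hf : Continuous f) (hi : Function.Injective f) {σ τ υ : unitInterval} (h1 : σ ≤ τ)
    (h2 : τ ≤ υ) : dist (f σ) (f υ) = dist (f σ) (f τ) + dist (f τ) (f υ) := by
  obtain ⟨L, ⟨e⟩⟩ := hp f hf hi
  let H : unitInterval → ℝ := fun τ => e ⟨f τ, Set.mem_range_self τ⟩
  have hH : ∀ a b, dist (f a) (f b) = |H a - H b| := fun a b => by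
    have := e.dist_eq ⟨f a, Set.mem_range_self a⟩ ⟨f b, Set.mem_range_self b⟩
    rw [Subtype.dist_eq, Subtype.dist_eq, Real.dist_eq] at this
    exact this.symm
  have hc : Continuous H :=
    continuous_subtype_val.comp (e.continuous.comp (hf.subtype_mk _))
  have hinj : Function.Injective H := fun a b hab => hi (by
    rw [← dist_eq_zero, hH, hab, sub_self, abs_zero])
  rw [hH, hH, hH]
  rcases hc.strictMono_of_inj hinj with hm | hm
  · have a1 := hm.monotone h1
    have a2 := hm.monotone h2
    rw [abs_of_nonpos (by linarith), abs_of_nonpos (by linarith), abs_of_nonpos (by linarith)]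
    ring
  · have a1 := hm.antitone h1
    have a2 := hm.antitone h2
    rw [abs_of_nonneg (by linarith), abs_of_nonneg (by linarith), abs_of_nonneg (by linarith)]
    ring

/-- Two geodesic arcs that meet only at a common endpoint form a geodesic arc. -/
theorem ArcsAreSegments.concat (hp : ArcsAreSegments X) {φ ψ : ℝ → X} {w r q : X}
    (hφ : IsGeodArc φ w r) (hψ : IsGeodArc ψ r q)
    (hd : ∀ s ∈ Set.Icc 0 (dist w r), ∀ t ∈ Set.Icc 0 (dist r q), φ s = ψ t → t = 0) :
    dist w q = dist w r + dist r q ∧ ∃ χ, IsGeodArc χ w q := by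
  rcases (dist_nonneg (x := w) (y := r)).eq_or_lt with ha | ha
  · obtain rfl := dist_eq_zero.1 ha.symm
    simpa using ⟨ψ, hψ⟩
  obtain ⟨hφ0, hφ1, hφ⟩ := hφ
  obtain ⟨hψ0, hψ1, hψ⟩ := hψ
  have hb := dist_nonneg (x := r) (y := q)
  set a := dist w r with hadef
  set b := dist r q with hbdef
  let c : ℝ → X := fun s => if s ≤ a then φ s else ψ (s - a)
  have c0 : c 0 = w := by simp [c, ha.le, hφ0]
  have ca : c a = r := by simp [c, hφ1]
  have cb : c (a + b) = q := by
    rcases hb.eq_or_lt with hb | hb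
    · rw [← hb, add_zero, ca]; exact dist_eq_zero.1 hb.symm
    · simp [c, hb, hψ1]
  have m1 : ∀ s ∈ Set.Icc 0 (a + b), s ≤ a → s ∈ Set.Icc 0 a := fun s hs h => ⟨hs.1, h⟩
  have m2 : ∀ s ∈ Set.Icc 0 (a + b), a ≤ s → s - a ∈ Set.Icc 0 b := fun s hs h =>
    ⟨by linarith, by linarith [hs.2]⟩
  have dL : ∀ s ∈ Set.Icc 0 (a + b), s ≤ a → dist (c s) r = a - s := fun s hs h => by
    have := hφ s (m1 s hs h) a ⟨ha.le, le_rfl⟩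
    rw [hφ1, abs_sub_comm, abs_of_nonneg (by linarith)] at this
    simpa [c, h] using this
  have dR : ∀ s ∈ Set.Icc 0 (a + b), a < s → dist r (c s) = s - a := fun s hs h => by
    have := hψ 0 ⟨le_rfl, hb⟩ _ (m2 s hs h.le)
    rw [hψ0, zero_sub, abs_neg, abs_of_nonneg (by linarith)] at this
    simpa [c, h.not_ge] using this
  have dLL : ∀ s ∈ Set.Icc 0 (a + b), ∀ t ∈ Set.Icc 0 (a + b), s ≤ a → t ≤ a →
      dist (c s) (c t) = |s - t| := fun s hs t ht h h' => by
    simpa [c, h, h'] using hφ s (m1 s hs h) t (m1 t ht h')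
  have dRR : ∀ s ∈ Set.Icc 0 (a + b), ∀ t ∈ Set.Icc 0 (a + b), a < s → a < t →
      dist (c s) (c t) = |s - t| := fun s hs t ht h h' => by
    have := hψ _ (m2 s hs h.le) _ (m2 t ht h'.le)
    rw [sub_sub_sub_cancel_right] at this
    simpa [c, h.not_ge, h'.not_ge] using this
  have dle : ∀ s ∈ Set.Icc 0 (a + b), ∀ t ∈ Set.Icc 0 (a + b), s ≤ t →
      dist (c s) (c t) ≤ t - s := fun s hs t ht hst => by
    rcases le_or_gt t a with h' | h'
    · rw [dLL s hs t ht (hst.trans h') h', abs_sub_comm, abs_of_nonneg (by linarith)]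
    rcases le_or_gt s a with h | h
    · linarith [dist_triangle (c s) r (c t), dL s hs h, dR t ht h']
    · rw [dRR s hs t ht h h', abs_sub_comm, abs_of_nonneg (by linarith)]
  have inj : ∀ s ∈ Set.Icc 0 (a + b), ∀ t ∈ Set.Icc 0 (a + b), s ≤ t → c s = c t → s = t :=
    fun s hs t ht hst heq => by
    rcases le_or_gt t a with h' | h'
    · have := dLL s hs t ht (hst.trans h') h'
      rw [heq, dist_self] at this
      linarith [abs_eq_zero.1 this.symm]
    rcases le_or_gt s a with h | h
    · have : φ s = ψ (t - a) := by simpa [c, h, h'.not_ge] using heq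
      linarith [hd s (m1 s hs h) _ (m2 t ht h'.le) this]
    · have := dRR s hs t ht h h'
      rw [heq, dist_self] at this
      linarith [abs_eq_zero.1 this.symm]
  have hab : 0 < a + b := by linarith
  have hmem : ∀ σ : unitInterval, (σ : ℝ) * (a + b) ∈ Set.Icc 0 (a + b) := fun σ =>
    ⟨mul_nonneg σ.2.1 hab.le, mul_le_of_le_one_left hab.le σ.2.2⟩
  let f : unitInterval → X := fun σ => c (σ * (a + b))
  have hflip : LipschitzWith (a + b).toNNReal f := by
    refine LipschitzWith.of_dist_le_mul fun σ τ => ?_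
    rw [Real.coe_toNNReal _ hab.le, Subtype.dist_eq, Real.dist_eq]
    rcases le_total σ τ with h | h
    · have h' : (σ : ℝ) ≤ τ := h
      have := dle _ (hmem σ) _ (hmem τ) (by gcongr)
      rw [abs_sub_comm, abs_of_nonneg (by linarith)]
      linarith
    · have h' : (τ : ℝ) ≤ σ := h
      have := dle _ (hmem τ) _ (hmem σ) (by gcongr)
      rw [abs_of_nonneg (by linarith), dist_comm]
      linarith
  have hfinj : Function.Injective f := by
    intro σ τ h
    rcases le_total σ τ with h' | h'
    · exact Subtype.ext (mul_right_cancel₀ hab.ne'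
        (inj _ (hmem σ) _ (hmem τ) (mul_le_mul_of_nonneg_right h' hab.le) h))
    · exact Subtype.ext (mul_right_cancel₀ hab.ne'
        (inj _ (hmem τ) _ (hmem σ) (mul_le_mul_of_nonneg_right h' hab.le) h.symm)).symm
  have hdiv : ∀ s ∈ Set.Icc 0 (a + b), s / (a + b) ∈ unitInterval := fun s hs =>
    ⟨div_nonneg hs.1 hab.le, div_le_one_of_le₀ hs.2 hab.le⟩
  have hfd : ∀ s (hs : s ∈ Set.Icc 0 (a + b)), f ⟨s / (a + b), hdiv s hs⟩ = c s := fun s hs => by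
    simp [f, hab.ne']
  have ham : a ∈ Set.Icc 0 (a + b) := ⟨ha.le, by linarith⟩
  have add : ∀ s ∈ Set.Icc 0 (a + b), ∀ t ∈ Set.Icc 0 (a + b), s ≤ a → a < t →
      dist (c s) (c t) = t - s := fun s hs t ht h h' => by
    have := hp.dist_eq_add hflip.continuous hfinj (σ := ⟨s / (a + b), hdiv s hs⟩)
      (τ := ⟨a / (a + b), hdiv a ham⟩) (υ := ⟨t / (a + b), hdiv t ht⟩)
      (by rw [Subtype.mk_le_mk]; gcongr) (by rw [Subtype.mk_le_mk]; gcongr)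
    rw [hfd s hs, hfd a ham, hfd t ht, ca, dL s hs h, dR t ht h'] at this
    linarith
  have key : ∀ s ∈ Set.Icc 0 (a + b), ∀ t ∈ Set.Icc 0 (a + b), s ≤ t →
      dist (c s) (c t) = t - s := fun s hs t ht hst => by
    rcases le_or_gt t a with h' | h'
    · rw [dLL s hs t ht (hst.trans h') h', abs_sub_comm, abs_of_nonneg (by linarith)]
    rcases le_or_gt s a with h | h
    · exact add s hs t ht h h'
    · rw [dRR s hs t ht h h', abs_sub_comm, abs_of_nonneg (by linarith)]
  have hwq : dist w q = a + b := by
    have := key 0 ⟨le_rfl, hab.le⟩ (a + b) ⟨hab.le, le_rfl⟩ hab.le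
    rwa [c0, cb, sub_zero] at this
  refine ⟨hwq, c, c0, by rw [hwq, cb], fun s hs t ht => ?_⟩
  rw [hwq] at hs ht
  rcases le_total s t with h | h
  · rw [key s hs t ht h, abs_sub_comm, abs_of_nonneg (by linarith)]
  · rw [dist_comm, key t ht s hs h, abs_of_nonneg (by linarith)]

/-- A point `w` joined to some point of a geodesic arc has a gate in this arc: the first point of
the arc met by a geodesic from `w`. -/
theorem ArcsAreSegments.exists_gate (hp : ArcsAreSegments X) {φ ψ : ℝ → X} {w x y : X} {t : ℝ}
    (hψ : IsGeodArc ψ x y) (ht : t ∈ Set.Icc 0 (dist x y)) (hφ : IsGeodArc φ w (ψ t)) :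
    ∃ t₀ ∈ Set.Icc 0 (dist x y), ∀ t₁ ∈ Set.Icc 0 (dist x y),
      dist w (ψ t₁) = dist w (ψ t₀) + |t₀ - t₁| ∧ ∃ χ, IsGeodArc χ w (ψ t₁) := by
  have hY : IsClosed (ψ '' Set.Icc 0 (dist x y)) :=
    (isCompact_Icc.image_of_continuousOn hψ.continuousOn).isClosed
  have hS : IsCompact (Set.Icc 0 (dist w (ψ t)) ∩ φ ⁻¹' (ψ '' Set.Icc 0 (dist x y))) :=
    isCompact_Icc.of_isClosed_subset
      (hφ.continuousOn.preimage_isClosed_of_isClosed isClosed_Icc hY) Set.inter_subset_left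
  obtain ⟨s₀, ⟨hs₀, t₀, ht₀, heq⟩, hmin⟩ := hS.exists_isLeast
    ⟨dist w (ψ t), ⟨dist_nonneg, le_rfl⟩, t, ht, hφ.2.1.symm⟩
  refine ⟨t₀, ht₀, fun t₁ ht₁ => ?_⟩
  obtain ⟨φ', hφ', hφs⟩ := hφ.exists_subarc ⟨le_rfl, dist_nonneg⟩ hs₀
  obtain ⟨ψ', hψ', hψs⟩ := hψ.exists_subarc ht₀ ht₁
  have e1 := hψ.2.2 t₀ ht₀ t₁ ht₁
  have e2 := hφ.2.2 0 ⟨le_rfl, dist_nonneg⟩ s₀ hs₀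
  rw [← e1]
  rw [← e1] at hψs
  rw [← e2] at hφs
  rw [hφ.1, ← heq] at hφ' hφs
  refine hp.concat hφ' hψ' fun s hs u hu hsu => ?_
  obtain ⟨v, hv, hv1, hv2⟩ := hφs s hs
  obtain ⟨v', hv', hv1', hv2'⟩ := hψs u hu
  -- the common point is on the arc, hence not before the first meeting point
  have h1 : s₀ ≤ v := hmin ⟨hv, v', hv', by rw [← hv1', ← hsu, hv1]⟩
  have h2 : v ≤ s₀ := by
    have := hs.2
    rw [heq, ← hφ.1, e2, ← hv2, zero_sub, zero_sub, abs_neg, abs_neg, abs_of_nonneg hv.1,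
      abs_of_nonneg hs₀.1] at this
    exact this
  have h3 : ψ' u = ψ' 0 := by rw [hψ'.1, ← hsu, hv1, le_antisymm h2 h1, heq]
  have h4 := hψ'.2.2 u hu 0 ⟨le_rfl, dist_nonneg⟩
  rw [h3, dist_self, sub_zero] at h4
  exact abs_eq_zero.1 h4.symm

theorem ArcsAreSegments.exists_trans (hp : ArcsAreSegments X) {w x y : X}
    (h1 : ∃ φ, IsGeodArc φ w x) (h2 : ∃ ψ, IsGeodArc ψ x y) : ∃ χ, IsGeodArc χ w y := by
  obtain ⟨φ, hφ⟩ := h1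
  obtain ⟨ψ, hψ⟩ := h2
  obtain ⟨t₀, -, h⟩ := hp.exists_gate hψ ⟨le_rfl, dist_nonneg⟩ (by rwa [hψ.1])
  have := (h (dist x y) ⟨dist_nonneg, le_rfl⟩).2
  rwa [hψ.2.1] at this

/-- If any two points are joined by a geodesic arc and all injective paths have images isometric to
segments, then the space is a real tree: the four-point condition follows by comparing the gates of
two of the points in an arc between the two others. -/
theorem ArcsAreSegments.isRealTree (hp : ArcsAreSegments X)
    (h : ∀ x y : X, ∃ φ, IsGeodArc φ x y) : IsRealTree X := by
  refine ⟨h, fun x y z w => ?_⟩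
  obtain ⟨ψ, hψ⟩ := h x y
  have hx : (0 : ℝ) ∈ Set.Icc 0 (dist x y) := ⟨le_rfl, dist_nonneg⟩
  have hy : dist x y ∈ Set.Icc 0 (dist x y) := ⟨dist_nonneg, le_rfl⟩
  obtain ⟨φz, hφz⟩ := h z (ψ 0)
  obtain ⟨φw, hφw⟩ := h w (ψ 0)
  obtain ⟨s, hs, hgs⟩ := hp.exists_gate hψ hx hφz
  obtain ⟨t, ht, hgt⟩ := hp.exists_gate hψ hx hφw
  have z1 := (hgs 0 hx).1
  have z2 := (hgs _ hy).1
  have w1 := (hgt 0 hx).1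
  have w2 := (hgt _ hy).1
  have hzw := dist_triangle4 z (ψ s) (ψ t) w
  rw [hψ.2.2 s hs t ht, dist_comm (ψ t)] at hzw
  rw [hψ.1, sub_zero, abs_of_nonneg hs.1] at z1
  rw [hψ.1, sub_zero, abs_of_nonneg ht.1] at w1
  rw [hψ.2.1, abs_sub_comm, abs_of_nonneg (by linarith [hs.2])] at z2
  rw [hψ.2.1, abs_sub_comm, abs_of_nonneg (by linarith [ht.2])] at w2
  rw [dist_comm x z, dist_comm x w, dist_comm y w, dist_comm y z, z1, z2, w1, w2, le_max_iff]
  rcases le_total s t with hst | hst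
  · rw [abs_sub_comm, abs_of_nonneg (by linarith)] at hzw
    right; linarith
  · rw [abs_of_nonneg (by linarith)] at hzw
    left; linarith

/-- Two points of a subset isometric to a real segment are joined by a geodesic arc. -/
theorem exists_isGeodArc_of_isometryEquiv {S : Set X} {L : ℝ} (e : S ≃ᵢ Set.Icc (0 : ℝ) L)
    {p q : X} (hpS : p ∈ S) (hqS : q ∈ S) : ∃ φ, IsGeodArc φ p q := by
  have hL : 0 ≤ L := (e ⟨p, hpS⟩).2.1.trans (e ⟨p, hpS⟩).2.2
  let φ : ℝ → X := fun t => e.symm (Set.projIcc 0 L hL t)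
  have hφ : ∀ s ∈ Set.Icc 0 L, ∀ t ∈ Set.Icc 0 L, dist (φ s) (φ t) = |s - t| := by
    intro s hs t ht
    have := e.symm.dist_eq (Set.projIcc 0 L hL s) (Set.projIcc 0 L hL t)
    rw [Subtype.dist_eq, Set.projIcc_of_mem hL hs, Set.projIcc_of_mem hL ht] at this
    simp only [φ, Set.projIcc_of_mem hL hs, Set.projIcc_of_mem hL ht]
    rw [this, Subtype.dist_eq, Real.dist_eq]
  have hd : dist (φ 0) (φ L) = L := by
    rw [hφ 0 ⟨le_rfl, hL⟩ L ⟨hL, le_rfl⟩, zero_sub, abs_neg, abs_of_nonneg hL]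
  have harc : IsGeodArc φ (φ 0) (φ L) := ⟨rfl, by rw [hd], by rwa [hd]⟩
  obtain ⟨χ, hχ, -⟩ := harc.exists_subarc (s := e ⟨p, hpS⟩) (t := e ⟨q, hqS⟩)
    (by rw [hd]; exact (e ⟨p, hpS⟩).2) (by rw [hd]; exact (e ⟨q, hqS⟩).2)
  exact ⟨χ, by simpa [φ] using hχ⟩

end Arcs

theorem mem_metricSegment_left {X : Type*} [MetricSpace X] (u v : X) : u ∈ metricSegment u v := by
  simp [metricSegment]

theorem mem_metricSegment_right {X : Type*} [MetricSpace X] (u v : X) :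
    v ∈ metricSegment u v := by
  simp [metricSegment]

/-! ### Simplicial real trees are real trees -/

namespace SimplicialRTree

theorem isRealTree {X : Type*} [MetricSpace X] (T : SimplicialRTree X) : IsRealTree X := by
  have hp : ArcsAreSegments X := T.path_isometric
  have hrefl : ∀ x : X, ∃ φ, IsGeodArc φ x x := fun x => ⟨fun _ => x, rfl, rfl, by
    intro s hs t ht
    simp only [dist_self, Set.Icc_self, Set.mem_singleton_iff] at *
    simp [hs, ht]⟩
  have hedge : ∀ u v : T.verts, T.graph.Adj u v → ∀ x ∈ metricSegment (u : X) v,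
      ∀ y ∈ metricSegment (u : X) v, ∃ φ, IsGeodArc φ x y := fun u v huv x hx y hy => by
    obtain ⟨e⟩ := T.edge_isometric u v huv
    exact exists_isGeodArc_of_isometryEquiv e hx hy
  have hvert : ∀ u v : T.verts, ∃ φ, IsGeodArc φ (u : X) v := fun u v => by
    obtain ⟨p⟩ := T.isTree.1.preconnected u v
    induction p with
    | nil => exact hrefl _
    | cons huv _ ih =>
      exact hp.exists_trans (hedge _ _ huv _ (mem_metricSegment_left _ _) _
        (mem_metricSegment_right _ _)) ih
  have hpt : ∀ x : X, ∃ u : T.verts, ∃ φ, IsGeodArc φ x u := fun x => by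
    rcases T.cover x with hx | ⟨u, v, huv, hx⟩
    · exact ⟨⟨x, hx⟩, hrefl x⟩
    · exact ⟨u, hedge u v huv x hx u (mem_metricSegment_left _ _)⟩
  refine hp.isRealTree fun x y => ?_
  obtain ⟨u, hu⟩ := hpt x
  obtain ⟨v, φ, hv⟩ := hpt y
  exact hp.exists_trans (hp.exists_trans hu (hvert u v)) hv.exists_symm

end SimplicialRTree

/-! ### Free cocompact actions on real trees -/

/-- `c 0, …, c n` is a sequence of points of `V` from `u` to `v`, with steps of length between `ε`
and `ℓ`, that lie in this order on a geodesic. -/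
structure IsGeodChain {X : Type*} [MetricSpace X] (V : Set X) (ε ℓ : ℝ) (u v : X) (n : ℕ)
    (c : ℕ → X) : Prop where
  apply_zero : c 0 = u
  apply_last : c n = v
  mem : ∀ i ≤ n, c i ∈ V
  step : ∀ i < n, ε ≤ dist (c i) (c (i + 1)) ∧ dist (c i) (c (i + 1)) ≤ ℓ
  dist_add : ∀ j ≤ n, ∀ i ≤ j, dist u (c j) = dist u (c i) + dist (c i) (c j)

/-- A free action, through `a`, of a group on a real tree with a cocompact invariant set `V` of
vertices, in the form needed below: `N` is the number of orbits of vertices, and the edges have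
lengths between `ε` and `ℓ`. -/
structure IsFreeCocompact {G X : Type*} [Group G] [MetricSpace X] (a : G →* (X ≃ᵢ X))
    (V : Set X) (N : ℕ) (ε ℓ : ℝ) : Prop where
  isRealTree : IsRealTree X
  apply_mem : ∀ γ, ∀ v ∈ V, a γ v ∈ V
  eps_pos : 0 < ε
  exists_near : ∀ x : X, ∃ v ∈ V, dist x v ≤ ℓ
  /-- any two vertices are joined by a geodesic sequence of edges -/
  exists_chain : ∀ u ∈ V, ∀ v ∈ V, ∃ n c, IsGeodChain V ε ℓ u v n c
  finite_ball : ∀ (x : X) (r : ℝ), (V ∩ Metric.closedBall x r).Finite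
  eq_one_of_apply_eq : ∀ γ x, a γ x = x → γ = 1
  /-- the orbits of vertices are labelled by a set with `N` elements -/
  exists_orbit_map : ∃ orb : X → Set X, (orb '' V).Finite ∧ (orb '' V).ncard = N ∧
    ∀ u ∈ V, ∀ v ∈ V, orb u = orb v → ∃ γ, a γ u = v

/-! ### Metric segments -/

theorem IsRealTree.metricSegment_subset_union {X : Type*} [MetricSpace X] (hX : IsRealTree X)
    (a b c : X) :
    metricSegment a c ⊆ metricSegment a b ∪ metricSegment b c := by
  intro r hr
  simp only [metricSegment, Set.mem_union, Set.mem_ofPred_eq] at *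
  have h := hX.four_point r b a c
  rw [dist_comm r a, dist_comm b a, le_max_iff] at h
  have t1 := dist_triangle a r b
  have t2 := dist_triangle b r c
  rw [dist_comm b r] at *
  rcases h with h | h
  · right; linarith
  · left; linarith

/-- A point of a metric segment in a real tree is determined by its distance to one endpoint. -/
theorem IsRealTree.eq_of_mem_metricSegment {X : Type*} [MetricSpace X] (hX : IsRealTree X)
    {u v x y : X} (hx : x ∈ metricSegment u v) (hy : y ∈ metricSegment u v)
    (h : dist u x = dist u y) : x = y := by
  simp only [metricSegment, Set.mem_ofPred_eq] at *
  have := hX.four_point x y u v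
  rw [dist_comm x u, dist_comm y u, le_max_iff] at this
  refine dist_le_zero.1 ?_
  rcases this with h | h <;> linarith

theorem dist_le_of_mem_metricSegment {X : Type*} [MetricSpace X] {u v x y : X}
    (hx : x ∈ metricSegment u v) (hy : y ∈ metricSegment u v) : dist x y ≤ dist u v := by
  simp only [metricSegment, Set.mem_ofPred_eq] at *
  have t1 := dist_triangle x u y
  have t2 := dist_triangle x v y
  rw [dist_comm x u] at t1
  rw [dist_comm v y] at t2
  linarith

theorem diam_metricSegment {X : Type*} [MetricSpace X] (u v : X) :
    Metric.diam (metricSegment u v) = dist u v := by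
  refine le_antisymm (Metric.diam_le_of_forall_dist_le dist_nonneg
    fun x hx y hy => dist_le_of_mem_metricSegment hx hy) ?_
  refine Metric.dist_le_diam_of_mem ?_ (mem_metricSegment_left u v) (mem_metricSegment_right u v)
  exact Metric.isBounded_iff.2 ⟨dist u v, fun x hx y hy => dist_le_of_mem_metricSegment hx hy⟩

theorem image_metricSegment {X : Type*} [MetricSpace X] (g : X ≃ᵢ X) (u v : X) :
    g '' metricSegment u v = metricSegment (g u) (g v) := by
  ext x
  constructor
  · rintro ⟨y, hy, rfl⟩
    simpa [metricSegment, g.dist_eq] using hy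
  · intro hx
    refine ⟨g.symm x, ?_, g.apply_symm_apply x⟩
    simp only [metricSegment, Set.mem_ofPred_eq] at *
    rw [← g.dist_eq u, ← g.dist_eq _ v, g.apply_symm_apply, hx, g.dist_eq]

/-! ### Discrete torsion-free groups of automorphisms of a simplicial real tree -/

namespace SimplicialRTree

variable {X : Type*} [MetricSpace X] (T : SimplicialRTree X)

/-- A path without repeated vertices in the combinatorial tree is geodesic, and its edges cover the
metric segment between its endpoints. -/
theorem chain_of_isPath {u v : T.verts} (p : T.graph.Walk u v) (hp : p.IsPath) :
    (∀ x ∈ metricSegment (u : X) v, x = u ∨ ∃ a ∈ p.support, ∃ b ∈ p.support,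
      T.graph.Adj a b ∧ x ∈ metricSegment (a : X) b) ∧
    ∃ c : ℕ → T.verts, c 0 = u ∧ c p.length = v ∧
      (∀ i < p.length, T.graph.Adj (c i) (c (i + 1))) ∧
      ∀ j ≤ p.length, ∀ i ≤ j,
        dist (u : X) (c j) = dist (u : X) (c i) + dist (c i : X) (c j) := by
  induction p with
  | nil =>
    refine ⟨fun x hx => ?_, fun _ => _, rfl, rfl, by simp, by simp⟩
    left
    simp only [metricSegment, Set.mem_ofPred_eq, dist_self] at hx
    rw [dist_comm x, ← two_mul] at hx
    exact (dist_eq_zero.1 (by linarith)).symm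
  | @cons u w v h p ih =>
    rw [SimpleGraph.Walk.cons_isPath_iff] at hp
    obtain ⟨ih1, c, hc0, hcn, hadj, hc⟩ := ih hp.1
    have hX := T.isRealTree
    have hadd : dist (u : X) v = dist (u : X) w + dist (w : X) v := by
      -- the median of `u`, `w`, `v` lies on the first edge and on the rest of the path
      obtain ⟨m, hm1, hm2, hm3⟩ := hX.exists_median (u : X) w v
      suffices m = w by
        subst this
        exact Eq.symm hm2
      rcases ih1 m hm3 with rfl | ⟨a, ha, b, hb, hab, hm⟩
      · rfl
      have hne : s(u, w) ≠ s(a, b) := by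
        intro heq
        rcases Sym2.eq_iff.1 heq with ⟨rfl, -⟩ | ⟨rfl, -⟩
        · exact hp.2 ha
        · exact hp.2 hb
      have hmv := T.edge_inter u w a b h hab hne ⟨hm1, hm⟩
      rcases T.vertex_of_mem_edge u w ⟨m, hmv⟩ h hm1 with h1 | h1
      · exfalso
        rcases T.vertex_of_mem_edge a b ⟨m, hmv⟩ hab hm with h2 | h2
        · exact hp.2 (by rwa [← h1, h2])
        · exact hp.2 (by rwa [← h1, h2])
      · exact congrArg Subtype.val h1
    refine ⟨fun x hx => ?_, fun i => Nat.casesOn (motive := fun _ => T.verts) i u c, rfl, hcn, fun i hi => ?_,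
      fun j hj i hij => ?_⟩
    · rcases hX.metricSegment_subset_union _ w _ hx with hx | hx
      · exact Or.inr ⟨u, by simp, w, by simp, h, hx⟩
      · rcases ih1 x hx with rfl | ⟨a, ha, b, hb, hab, hm⟩
        · exact Or.inr ⟨u, by simp, w, by simp, h, mem_metricSegment_right _ _⟩
        · exact Or.inr ⟨a, by simp [ha], b, by simp [hb], hab, hm⟩
    · rcases i with _ | i
      · simpa [hc0] using h
      · exact hadj i (by simpa using hi)
    · rcases i with _ | i
      · simp
      rcases j with _ | j
      · omega
      have hj' : j ≤ p.length := by simpa using hj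
      have key : ∀ k ≤ p.length,
          dist (u : X) (c k) = dist (u : X) w + dist (w : X) (c k) := fun k hk => by
        have h1 := hc p.length le_rfl k hk
        rw [hcn] at h1
        refine le_antisymm (dist_triangle _ _ _) ?_
        linarith [dist_triangle (u : X) (c k) v]
      change dist (u : X) (c j) = dist (u : X) (c i) + dist (c i : X) (c j)
      rw [key j hj', key i (by omega), hc j hj' i (by omega), add_assoc]

theorem exists_chain (u v : T.verts) : ∃ (n : ℕ) (c : ℕ → T.verts), c 0 = u ∧ c n = v ∧
    (∀ i < n, T.graph.Adj (c i) (c (i + 1))) ∧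
    ∀ j ≤ n, ∀ i ≤ j, dist (u : X) (c j) = dist (u : X) (c i) + dist (c i : X) (c j) := by
  obtain ⟨p, hp, -⟩ := T.isTree.existsUnique_path u v
  obtain ⟨-, c, hc⟩ := T.chain_of_isPath p hp
  exact ⟨p.length, c, hc⟩

theorem finite_edgeLengths (Γ : Subgroup T.Isom) (h : (T.quotientEdges Γ).Finite) :
    {r | ∃ u v : T.verts, T.graph.Adj u v ∧ r = dist (u : X) v}.Finite := by
  refine (h.image fun O => sSup (Metric.diam '' O)).subset ?_
  rintro r ⟨u, v, huv, rfl⟩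
  refine ⟨_, ⟨metricSegment (u : X) v, ⟨u, v, huv, rfl⟩, rfl⟩, ?_⟩
  -- all the edges of an orbit have the same diameter
  suffices Metric.diam '' {e' | ∃ γ : Γ, e' = ((γ : T.Isom) : X ≃ᵢ X) '' metricSegment (u : X) v} =
      {dist (u : X) v} by
    simp only [this, csSup_singleton]
  ext r
  constructor
  · rintro ⟨_, ⟨γ, rfl⟩, rfl⟩
    rw [image_metricSegment, diam_metricSegment, IsometryEquiv.dist_eq]
    rfl
  · rintro rfl
    exact ⟨metricSegment (u : X) v, ⟨1, by simp⟩, diam_metricSegment _ _⟩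

theorem exists_edgeLength_bounds (Γ : Subgroup T.Isom) (h : (T.quotientEdges Γ).Finite) :
    ∃ ε > 0, ∀ u v : T.verts, T.graph.Adj u v →
      ε ≤ dist (u : X) v ∧ dist (u : X) v ≤ T.maxEdgeLength := by
  have hfin := T.finite_edgeLengths Γ h
  have hpos : ∀ u v : T.verts, T.graph.Adj u v → 0 < dist (u : X) v := fun u v huv =>
    dist_pos.2 fun h => huv.ne (Subtype.ext h)
  have hmax : ∀ u v : T.verts, T.graph.Adj u v → dist (u : X) v ≤ T.maxEdgeLength :=
    fun u v huv => le_csSup hfin.bddAbove ⟨u, v, huv, rfl⟩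
  rcases Set.eq_empty_or_nonempty
    {r | ∃ u v : T.verts, T.graph.Adj u v ∧ r = dist (u : X) v} with he | hne
  · refine ⟨1, one_pos, fun u v huv => ?_⟩
    have : dist (u : X) v ∈ (∅ : Set ℝ) := he ▸ ⟨u, v, huv, rfl⟩
    exact this.elim
  · obtain ⟨ε, ⟨u₀, v₀, h₀, rfl⟩, hε⟩ := Set.exists_min_image _ id hfin hne
    exact ⟨_, hpos _ _ h₀, fun u v huv => ⟨hε _ ⟨u, v, huv, rfl⟩, hmax u v huv⟩⟩

theorem exists_adj_mem_metricSegment (hT : T.ValenceGETwo) (x : X) :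
    ∃ u v : T.verts, T.graph.Adj u v ∧ x ∈ metricSegment (u : X) v := by
  rcases T.cover x with hx | h
  · have h2 := hT ⟨x, hx⟩
    obtain ⟨v, hv⟩ : (T.graph.neighborSet ⟨x, hx⟩).Nonempty := by
      rw [← Set.encard_pos]
      exact lt_of_lt_of_le (by norm_num) h2
    exact ⟨⟨x, hx⟩, v, hv, mem_metricSegment_left _ _⟩
  · exact h

theorem finite_verts_of_dist_lt (hfin : T.IsLocallyFinite) {ε : ℝ}
    (hε : ∀ u v : T.verts, T.graph.Adj u v → ε ≤ dist (u : X) v) (n : ℕ) (v : T.verts) :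
    {u : T.verts | dist (v : X) u < n * ε}.Finite := by
  induction n generalizing v with
  | zero =>
    refine Set.finite_empty.subset fun u hu => ?_
    have : dist (v : X) u < 0 := by simpa using hu
    exact absurd this dist_nonneg.not_gt
  | succ n ih =>
    refine ((Set.finite_singleton v).union ((hfin v).biUnion fun w _ => ih w)).subset ?_
    intro u hu
    have hu' : dist (v : X) u < (n + 1) * ε := by simpa using hu
    obtain ⟨m, c, hc0, hcm, hadj, hc⟩ := T.exists_chain v u
    rcases m with _ | m
    · left
      rw [Set.mem_singleton_iff, ← hc0, ← hcm]
    · right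
      have h1 := hadj 0 (by omega)
      have h2 := hc (m + 1) le_rfl 1 (by omega)
      rw [hcm] at h2
      rw [hc0] at h1
      have h3 := hε _ _ h1
      refine Set.mem_biUnion (x := c 1) h1 ?_
      simp only [Set.mem_ofPred_eq]
      simp only [zero_add] at h3
      linarith

theorem finite_verts_inter_closedBall (hfin : T.IsLocallyFinite) {ε : ℝ} (hε0 : 0 < ε)
    (hε : ∀ u v : T.verts, T.graph.Adj u v → ε ≤ dist (u : X) v) (x : X) (r : ℝ) :
    (T.verts ∩ Metric.closedBall x r).Finite := by
  obtain ⟨v⟩ := T.isTree.1.nonempty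
  obtain ⟨n, hn⟩ := exists_nat_gt ((dist (v : X) x + r) / ε)
  rw [div_lt_iff₀ hε0] at hn
  refine ((T.finite_verts_of_dist_lt hfin hε n v).image Subtype.val).subset ?_
  rintro u ⟨hu, hur⟩
  refine ⟨⟨u, hu⟩, ?_, rfl⟩
  have h1 : dist u x ≤ r := hur
  have := dist_triangle (v : X) x u
  rw [dist_comm x u] at this
  simp only [Set.mem_ofPred_eq]
  linarith

/-- Every neighbourhood of `g` contains the isometries that agree with `g` on some compact set. -/
theorem exists_isCompact_of_isOpen {U : Set T.Isom} (hU : IsOpen U) {g : T.Isom} (hg : g ∈ U) :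
    ∃ K : Set X, IsCompact K ∧
      ∀ h : T.Isom, (∀ x ∈ K, (h : X ≃ᵢ X) x = (g : X ≃ᵢ X) x) → h ∈ U := by
  induction hU with
  | basic U hU =>
    obtain ⟨k, K, hK, rfl⟩ := hU
    exact ⟨K, hK, fun h hh x hx => (hh x hx).trans (hg x hx)⟩
  | univ => exact ⟨∅, isCompact_empty, fun _ _ => trivial⟩
  | inter U V _ _ ihU ihV =>
    obtain ⟨K, hK, hK'⟩ := ihU hg.1
    obtain ⟨L, hL, hL'⟩ := ihV hg.2
    exact ⟨K ∪ L, hK.union hL, fun h hh =>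
      ⟨hK' h fun x hx => hh x (Or.inl hx), hL' h fun x hx => hh x (Or.inr hx)⟩⟩
  | sUnion S _ ih =>
    obtain ⟨U, hU, hgU⟩ := hg
    obtain ⟨K, hK, hK'⟩ := ih U hU hgU
    exact ⟨K, hK, fun h hh => ⟨U, hU, hK' h hh⟩⟩

theorem exists_isCompact_of_discrete (Γ : Subgroup T.Isom) (hdisc : DiscreteTopology Γ) :
    ∃ K : Set X, IsCompact K ∧
      ∀ γ : Γ, (∀ x ∈ K, ((γ : T.Isom) : X ≃ᵢ X) x = x) → γ = 1 := by
  obtain ⟨U, hU, hU1⟩ := isOpen_induced_iff.1 (isOpen_discrete ({1} : Set Γ))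
  have h1 : (1 : T.Isom) ∈ U := by
    have : (1 : Γ) ∈ Subtype.val ⁻¹' U := by rw [hU1]; rfl
    exact this
  obtain ⟨K, hK, hK'⟩ := T.exists_isCompact_of_isOpen hU h1
  refine ⟨K, hK, fun γ hγ => ?_⟩
  have : γ ∈ Subtype.val ⁻¹' U := hK' γ hγ
  rwa [hU1] at this

/-- A discrete torsion-free group acts freely: the powers of an element fixing a point permute
finitely many vertices, and two of them agree on a given compact set. -/
theorem eq_one_of_apply_eq (hT : T.ValenceGETwo) (hfin : T.IsLocallyFinite) (Γ : Subgroup T.Isom)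
    (hdisc : DiscreteTopology Γ) (htf : ∀ γ : Γ, γ ≠ 1 → ¬ IsOfFinOrder γ)
    (hquotE : (T.quotientEdges Γ).Finite) (γ : Γ) (m : X)
    (hm : ((γ : T.Isom) : X ≃ᵢ X) m = m) : γ = 1 := by
  by_contra hne
  obtain ⟨ε, hε0, hε⟩ := T.exists_edgeLength_bounds Γ hquotE
  obtain ⟨K, hK, hK'⟩ := T.exists_isCompact_of_discrete Γ hdisc
  obtain ⟨r, hr⟩ := hK.isBounded.subset_closedBall m
  have hW := T.finite_verts_inter_closedBall hfin hε0 (fun u v huv => (hε u v huv).1) m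
    (r + T.maxEdgeLength)
  set W := T.verts ∩ Metric.closedBall m (r + T.maxEdgeLength)
  have hfix : ∀ n : ℕ, (((γ ^ n : Γ) : T.Isom) : X ≃ᵢ X) m = m := by
    intro n
    induction n with
    | zero => simp
    | succ n ih =>
      rw [pow_succ]
      change (((γ ^ n : Γ) : T.Isom) : X ≃ᵢ X) (((γ : T.Isom) : X ≃ᵢ X) m) = m
      rw [hm, ih]
  have hmaps : ∀ (n : ℕ) (w : W), (((γ ^ n : Γ) : T.Isom) : X ≃ᵢ X) w ∈ W := fun n w => by
    refine ⟨((γ ^ n : Γ) : T.Isom).2.1 _ |>.2 w.2.1, ?_⟩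
    have h1 := w.2.2
    rw [Metric.mem_closedBall] at h1 ⊢
    rw [← hfix n, IsometryEquiv.dist_eq]
    exact h1
  have : Finite W := hW
  obtain ⟨i, j, hij, heq⟩ := Finite.exists_ne_map_eq_of_infinite
    (fun (n : ℕ) (w : W) => (⟨_, hmaps n w⟩ : W))
  wlog hlt : i < j generalizing i j
  · exact this j i hij.symm heq.symm (by omega)
  have hfixW : ∀ w ∈ W, (((γ ^ (j - i) : Γ) : T.Isom) : X ≃ᵢ X) w = w := fun w hw => by
    have h1 := congrArg Subtype.val (congrFun heq ⟨w, hw⟩)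
    change (((γ ^ i : Γ) : T.Isom) : X ≃ᵢ X) w = (((γ ^ j : Γ) : T.Isom) : X ≃ᵢ X) w at h1
    have h2 : γ ^ j = γ ^ i * γ ^ (j - i) := by rw [← pow_add]; congr 1; omega
    rw [h2] at h1
    exact ((((γ ^ i : Γ) : T.Isom) : X ≃ᵢ X).injective h1).symm
  have h1 : γ ^ (j - i) = 1 := hK' _ fun x hx => by
    obtain ⟨u, v, huv, hxuv⟩ := T.exists_adj_mem_metricSegment hT x
    have hmem : ∀ w ∈ T.verts, w ∈ metricSegment (u : X) v → w ∈ W := fun w hw hwe => by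
      refine ⟨hw, ?_⟩
      rw [Metric.mem_closedBall]
      have h1 := dist_le_of_mem_metricSegment hwe hxuv
      have h2 : dist x m ≤ r := hr hx
      linarith [dist_triangle w x m, (hε u v huv).2]
    have hu := hfixW u (hmem u u.2 (mem_metricSegment_left _ _))
    have hv := hfixW v (hmem v v.2 (mem_metricSegment_right _ _))
    set g := (((γ ^ (j - i) : Γ) : T.Isom) : X ≃ᵢ X)
    have h3 : g x ∈ metricSegment (u : X) v := by
      rw [← hu, ← hv, ← image_metricSegment]
      exact ⟨x, hxuv, rfl⟩
    refine T.isRealTree.eq_of_mem_metricSegment h3 hxuv ?_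
    conv_lhs => rw [← hu, g.dist_eq]
  exact htf γ hne (isOfFinOrder_iff_pow_eq_one.2 ⟨j - i, by omega, h1⟩)

theorem isFreeCocompact (hT : T.ValenceGETwo) (hfin : T.IsLocallyFinite) (Γ : Subgroup T.Isom)
    (hdisc : DiscreteTopology Γ) (htf : ∀ γ : Γ, γ ≠ 1 → ¬ IsOfFinOrder γ)
    (hquotV : (T.quotientVerts Γ).Finite) (hquotE : (T.quotientEdges Γ).Finite) :
    ∃ ε, IsFreeCocompact (T.Isom.subtype.comp Γ.subtype) T.verts (T.quotientVerts Γ).ncard ε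
      T.maxEdgeLength := by
  obtain ⟨ε, hε0, hε⟩ := T.exists_edgeLength_bounds Γ hquotE
  refine ⟨ε, T.isRealTree, fun γ v hv => ((γ : T.Isom).2.1 v).2 hv, hε0, fun x => ?_,
    fun u hu v hv => ?_, T.finite_verts_inter_closedBall hfin hε0 fun u v huv => (hε u v huv).1,
    T.eq_one_of_apply_eq hT hfin Γ hdisc htf hquotE,
    fun v => {x | ∃ γ : Γ, x = ((γ : T.Isom) : X ≃ᵢ X) v}, ?_, ?_, fun u hu v hv huv => ?_⟩
  · obtain ⟨u, v, huv, hx⟩ := T.exists_adj_mem_metricSegment hT x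
    exact ⟨u, u.2, (dist_le_of_mem_metricSegment hx (mem_metricSegment_left _ _)).trans
      (hε u v huv).2⟩
  · obtain ⟨n, c, h0, hn, hadj, hc⟩ := T.exists_chain ⟨u, hu⟩ ⟨v, hv⟩
    exact ⟨n, fun i => c i, congrArg Subtype.val h0, congrArg Subtype.val hn, fun i _ => (c i).2,
      fun i hi => hε _ _ (hadj i hi), fun j hj i hij => hc j hj i hij⟩
  · refine hquotV.subset ?_
    rintro _ ⟨v, hv, rfl⟩
    exact ⟨v, hv, rfl⟩
  · congr 1
    ext O
    exact ⟨fun ⟨v, hv, h⟩ => ⟨v, hv, h.symm⟩, fun ⟨v, hv, h⟩ => ⟨v, hv, h.symm⟩⟩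
  · have : v ∈ {x | ∃ γ : Γ, x = ((γ : T.Isom) : X ≃ᵢ X) u} := by
      have h1 : v ∈ {x | ∃ γ : Γ, x = ((γ : T.Isom) : X ≃ᵢ X) v} := ⟨1, rfl⟩
      exact (Set.ext_iff.1 huv v).2 h1
    obtain ⟨γ, hγ⟩ := this
    exact ⟨γ, hγ.symm⟩

/-- A finite tree has a vertex of valence at most one. -/
theorem infinite_verts (hT : T.ValenceGETwo) : T.verts.Infinite := by
  classical
  intro hfin
  have : Fintype T.verts := hfin.fintype
  obtain ⟨v⟩ := T.isTree.1.nonempty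
  have hdeg : ∀ v, 2 ≤ T.graph.degree v := fun v => by
    have := hT v
    rw [← SimpleGraph.coe_neighborFinset, Set.encard_coe_eq_coe_finsetCard,
      SimpleGraph.card_neighborFinset_eq_degree] at this
    exact_mod_cast this
  have : Nontrivial T.verts := by
    have := hdeg v
    obtain ⟨w, hw⟩ := (T.graph.degree_pos_iff_exists_adj v).1 (by omega)
    exact ⟨v, w, hw.ne⟩
  obtain ⟨w, hw⟩ := T.isTree.exists_vert_degree_one_of_nontrivial
  have := hdeg w
  omega

theorem exists_ne_one (hT : T.ValenceGETwo) (Γ : Subgroup T.Isom)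
    (hquotV : (T.quotientVerts Γ).Finite) : ∃ γ : Γ, γ ≠ 1 := by
  by_contra! h
  refine T.infinite_verts hT ?_
  refine Set.Finite.of_finite_image (f := fun v => {x | ∃ γ : Γ, x = ((γ : T.Isom) : X ≃ᵢ X) v})
    (hquotV.subset ?_) fun u _ v _ huv => ?_
  · rintro _ ⟨v, hv, rfl⟩
    exact ⟨v, hv, rfl⟩
  · have h1 : u ∈ {x | ∃ γ : Γ, x = ((γ : T.Isom) : X ≃ᵢ X) u} := ⟨1, rfl⟩
    simp only at huv
    rw [huv] at h1
    obtain ⟨γ, hγ⟩ := h1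
    rw [h γ] at hγ
    exact hγ

end SimplicialRTree

/-! ### Orbits of vertices and short elements -/

namespace IsGeodChain

variable {X : Type*} [MetricSpace X] {V : Set X} {ε ℓ : ℝ} {u v : X} {n : ℕ} {c : ℕ → X}

theorem dist_le (h : IsGeodChain V ε ℓ u v n c) : dist u v ≤ n * ℓ := by
  have key : ∀ i ≤ n, dist u (c i) ≤ i * ℓ := fun i => by
    induction i with
    | zero => simp [h.apply_zero]
    | succ i ih =>
      intro hi
      have h1 := ih (by omega)
      have h2 := (h.step i (by omega)).2
      push_cast
      linarith [dist_triangle u (c i) (c (i + 1))]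
  simpa [h.apply_last] using key n le_rfl

theorem le_dist (h : IsGeodChain V ε ℓ u v n c) {i j : ℕ} (hij : i < j) (hj : j ≤ n) :
    ε ≤ dist (c i) (c j) := by
  have h1 := h.dist_add j hj i hij.le
  have h2 := h.dist_add j hj (i + 1) hij
  have h3 := h.dist_add (i + 1) (by omega) i (by omega)
  have h4 := (h.step i (by omega)).1
  linarith [dist_nonneg (x := c (i + 1)) (y := c j)]

end IsGeodChain

namespace IsFreeCocompact

variable {G X : Type*} [Group G] [MetricSpace X] {a : G →* (X ≃ᵢ X)} {V : Set X} {N : ℕ} {ε ℓ : ℝ}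
  (h : IsFreeCocompact a V N ε ℓ)
include h

theorem length_nonneg [Nonempty X] : 0 ≤ ℓ := by
  obtain ⟨v, -, hv⟩ := h.exists_near (Classical.arbitrary X)
  exact dist_nonneg.trans hv

/-- Among more than `N` consecutive points of a chain, two are in the same orbit. -/
theorem exists_same_orbit {u v : X} {n : ℕ} {c : ℕ → X} (hc : IsGeodChain V ε ℓ u v n c) {m : ℕ}
    (hm : N < m) (hmn : m ≤ n + 1) : ∃ i j, i < j ∧ j < m ∧ ∃ γ, a γ (c i) = c j := by
  obtain ⟨orb, hfin, hcard, horb⟩ := h.exists_orbit_map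
  have hmaps : ∀ i ∈ Finset.range m, orb (c i) ∈ hfin.toFinset := fun i hi => by
    rw [Finset.mem_range] at hi
    exact hfin.mem_toFinset.2 ⟨c i, hc.mem i (by omega), rfl⟩
  obtain ⟨i, hi, j, hj, hij, heq⟩ := Finset.exists_ne_map_eq_of_card_lt_of_maps_to
    (by rw [Finset.card_range, ← Set.ncard_eq_toFinset_card _ hfin, hcard]; exact hm) hmaps
  rw [Finset.mem_range] at hi hj
  rcases lt_or_gt_of_ne hij with hlt | hlt
  · exact ⟨i, j, hlt, hj, horb _ (hc.mem i (by omega)) _ (hc.mem j (by omega)) heq⟩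
  · exact ⟨j, i, hlt, hi, horb _ (hc.mem j (by omega)) _ (hc.mem i (by omega)) heq.symm⟩

/-- Among more than `2 N` consecutive points of a chain, three are in the same orbit. -/
theorem exists_three_same_orbit {u v : X} {n : ℕ} {c : ℕ → X} (hc : IsGeodChain V ε ℓ u v n c)
    (hn : 2 * N < n) : ∃ i j k, i < j ∧ j < k ∧ k < n ∧
      (∃ α, a α (c i) = c j) ∧ ∃ η, a η (c i) = c k := by
  obtain ⟨orb, hfin, hcard, horb⟩ := h.exists_orbit_map
  have hmaps : ∀ i ∈ Finset.range n, orb (c i) ∈ hfin.toFinset := fun i hi => by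
    rw [Finset.mem_range] at hi
    exact hfin.mem_toFinset.2 ⟨c i, hc.mem i (by omega), rfl⟩
  classical
  obtain ⟨y, -, hy⟩ := Finset.exists_lt_card_fiber_of_mul_lt_card_of_maps_to (n := 2) hmaps
    (by rw [Finset.card_range, ← Set.ncard_eq_toFinset_card _ hfin, hcard]; omega)
  set S := {i ∈ Finset.range n | orb (c i) = y}
  let f := S.orderEmbOfCardLe (k := 3) (by omega)
  have hf : ∀ t, f t < n ∧ orb (c (f t)) = y := fun t => by
    have := S.orderEmbOfCardLe_mem (k := 3) (by omega) t
    simpa [S] using this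
  refine ⟨f 0, f 1, f 2, f.strictMono (by decide), f.strictMono (by decide), (hf 2).1,
    horb _ (hc.mem _ (hf 0).1.le) _ (hc.mem _ (hf 1).1.le) ((hf 0).2.trans (hf 1).2.symm),
    horb _ (hc.mem _ (hf 0).1.le) _ (hc.mem _ (hf 2).1.le) ((hf 0).2.trans (hf 2).2.symm)⟩

/-- The quotient graph has diameter at most `(N - 1) ℓ`: a chain to an orbit that visits an orbit
twice can be shortened. -/
theorem exists_dist_apply_le {p q : X} (hp : p ∈ V) (hq : q ∈ V) :
    ∃ g, dist p (a g q) ≤ (N - 1) * ℓ := by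
  have : Nonempty X := ⟨p⟩
  have key : ∀ n : ℕ, ∀ g, dist p (a g q) < n * ε → ∃ g, dist p (a g q) ≤ (N - 1) * ℓ := by
    intro n
    induction n with
    | zero =>
      intro g hg
      rw [Nat.cast_zero, zero_mul] at hg
      exact absurd hg dist_nonneg.not_gt
    | succ n ih =>
      intro g hg
      obtain ⟨m, c, hc⟩ := h.exists_chain p hp _ (h.apply_mem g q hq)
      rcases Nat.lt_or_ge N (m + 1) with hm | hm
      · obtain ⟨i, j, hij, hj, γ, hγ⟩ := h.exists_same_orbit hc hm le_rfl
        refine ih (γ⁻¹ * g) ?_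
        have h1 : dist (c i) (a (γ⁻¹ * g) q) = dist (c j) (c m) := by
          rw [← hγ, hc.apply_last, ← (a γ).dist_eq, ← IsometryEquiv.mul_apply (a γ), ← map_mul,
            mul_inv_cancel_left]
        have h2 := hc.le_dist hij (by omega)
        have h3 := hc.dist_add m le_rfl j (by omega)
        have h4 := hc.dist_add j (by omega) i hij.le
        have h5 := dist_triangle p (c i) (a (γ⁻¹ * g) q)
        rw [hc.apply_last] at h3 h1
        push_cast at hg
        linarith
      · refine ⟨g, hc.dist_le.trans ?_⟩
        have : (m : ℝ) + 1 ≤ N := by exact_mod_cast hm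
        exact mul_le_mul_of_nonneg_right (by linarith) h.length_nonneg
  obtain ⟨n, hn⟩ := exists_nat_gt (dist p (a 1 q) / ε)
  rw [div_lt_iff₀ h.eps_pos] at hn
  exact key n 1 hn

theorem exists_dist_apply_le_of_point (x y : X) : ∃ g, dist x (a g y) ≤ (N + 1) * ℓ := by
  obtain ⟨p, hp, hxp⟩ := h.exists_near x
  obtain ⟨q, hq, hyq⟩ := h.exists_near y
  obtain ⟨g, hg⟩ := h.exists_dist_apply_le hp hq
  refine ⟨g, ?_⟩
  have h1 : dist (a g q) (a g y) = dist y q := by rw [(a g).dist_eq, dist_comm]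
  linarith [dist_triangle4 x p (a g q) (a g y)]

/-- An element moving some vertex by at most `2 N ℓ` has a conjugate moving `x₀` by at most
`4 N ℓ`. -/
theorem exists_conj_dist_le (x₀ : X) {γ : G} {p : X} (hp : p ∈ V)
    (hγ : dist p (a γ p) ≤ 2 * N * ℓ) :
    ∃ g, dist x₀ (a (g * γ * g⁻¹) x₀) ≤ 4 * N * ℓ := by
  obtain ⟨q, hq, hxq⟩ := h.exists_near x₀
  obtain ⟨k, hk⟩ := h.exists_dist_apply_le hp hq
  refine ⟨k⁻¹, ?_⟩
  have h1 : dist x₀ (a (k⁻¹ * γ * k⁻¹⁻¹) x₀) = dist (a k x₀) (a γ (a k x₀)) := by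
    rw [← (a k).dist_eq, ← IsometryEquiv.mul_apply (a k), ← IsometryEquiv.mul_apply (a γ),
      ← map_mul, ← map_mul]
    congr 3
    group
  have h2 : dist (a k x₀) (a k q) = dist x₀ q := (a k).dist_eq _ _
  have h3 : dist (a γ p) (a γ (a k x₀)) = dist p (a k x₀) := (a γ).dist_eq _ _
  rw [h1]
  have h4 := dist_triangle4 (a k x₀) p (a γ p) (a γ (a k x₀))
  have h5 := dist_triangle p (a k q) (a k x₀)
  rw [dist_comm (a k x₀) p] at h4
  rw [dist_comm (a k q)] at h5
  linarith

theorem finite_dist_le (x₀ : X) (R : ℝ) : {γ | dist x₀ (a γ x₀) ≤ R}.Finite := by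
  obtain ⟨p, hp, -⟩ := h.exists_near x₀
  refine Set.Finite.of_finite_image (f := fun γ => a γ p)
    ((h.finite_ball x₀ (R + dist x₀ p)).subset ?_) fun γ _ δ _ hγδ => ?_
  · rintro _ ⟨γ, hγ, rfl⟩
    refine ⟨h.apply_mem γ p hp, ?_⟩
    have hγ' : dist x₀ (a γ x₀) ≤ R := hγ
    rw [Metric.mem_closedBall, dist_comm]
    refine (dist_triangle _ (a γ x₀) _).trans ?_
    rw [(a γ).dist_eq]
    linarith
  · simp only at hγδ
    have : δ⁻¹ * γ = 1 := h.eq_one_of_apply_eq _ p (by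
      rw [map_mul, IsometryEquiv.mul_apply, hγδ, ← IsometryEquiv.mul_apply, ← map_mul,
        inv_mul_cancel, map_one, IsometryEquiv.coe_one, id])
    exact (inv_mul_eq_one.1 this).symm

theorem translationLength_pos [Nonempty X] {γ : G} (hγ : γ ≠ 1) : 0 < translationLength (a γ) := by
  refine (translationLength_nonneg _).lt_of_ne fun h0 => hγ ?_
  obtain ⟨m, hm⟩ := h.isRealTree.exists_dist_eq_translationLength (a γ)
  rw [← h0] at hm
  exact h.eq_one_of_apply_eq γ m (dist_eq_zero.1 hm).symm

theorem exists_ne_one_dist_le (hG : ∃ γ : G, γ ≠ 1) (x₀ : X) :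
    ∃ γ : G, γ ≠ 1 ∧ dist x₀ (a γ x₀) ≤ 4 * N * ℓ := by
  have : Nonempty X := ⟨x₀⟩
  obtain ⟨p, hp, -⟩ := h.exists_near x₀
  have key : ∀ n : ℕ, ∀ γ ≠ 1, ∀ p ∈ V, dist p (a γ p) < n * ε →
      ∃ γ ≠ 1, ∃ p ∈ V, dist p (a γ p) ≤ N * ℓ := by
    intro n
    induction n with
    | zero =>
      intro γ _ p _ hg
      rw [Nat.cast_zero, zero_mul] at hg
      exact absurd hg dist_nonneg.not_gt
    | succ n ih =>
      intro γ hγ p hp hlt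
      obtain ⟨m, c, hc⟩ := h.exists_chain p hp _ (h.apply_mem γ p hp)
      rcases Nat.lt_or_ge N m with hm | hm
      · obtain ⟨i, j, hij, hj, α, hα⟩ := h.exists_same_orbit hc hm (by omega)
        have h1 := hc.le_dist hij hj.le
        refine ih α ?_ (c i) (hc.mem i (by omega)) ?_
        · rintro rfl
          rw [map_one, IsometryEquiv.coe_one, id] at hα
          rw [hα, dist_self] at h1
          exact absurd h.eps_pos h1.not_gt
        · have h2 := hc.le_dist hj le_rfl
          have h3 := hc.dist_add m le_rfl j hj.le
          have h4 := hc.dist_add j hj.le i hij.le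
          rw [hc.apply_last] at h2 h3
          rw [hα]
          push_cast at hlt
          linarith [dist_nonneg (x := p) (y := c i)]
      · refine ⟨γ, hγ, p, hp, hc.dist_le.trans ?_⟩
        have : (m : ℝ) ≤ N := by exact_mod_cast hm
        exact mul_le_mul_of_nonneg_right this h.length_nonneg
  obtain ⟨γ, hγ⟩ := hG
  obtain ⟨n, hn⟩ := exists_nat_gt (dist p (a γ p) / ε)
  rw [div_lt_iff₀ h.eps_pos] at hn
  obtain ⟨γ, hγ, p, hp, hle⟩ := key n γ hγ p hp hn
  have hNl : 0 ≤ (N : ℝ) * ℓ := mul_nonneg N.cast_nonneg h.length_nonneg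
  obtain ⟨g, hg⟩ := h.exists_conj_dist_le x₀ hp (by linarith)
  exact ⟨g * γ * g⁻¹, by simpa using hγ, hg⟩

/-! ### Comparison with a second action -/

section Representation

variable {X' : Type*} [MetricSpace X'] (hX' : IsRealTree X') {b : G →* (X' ≃ᵢ X')}
include hX'

/-- If `λ(b γ) ≤ M λ(a γ)` for the elements moving `x₀` by at most `4 N ℓ`, then
`λ(b γ) ≤ M d(p, a γ p)` for all `γ` and all vertices `p`. A long path from `p` to `γ p` visits some
orbit three times, so that a conjugate of `γ` is a product of three elements, each of which, as well
as the product of any two, satisfies the inequality by induction; and these inequalities yield a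
point of `X'` that is moved little by the three of them. -/
theorem translationLength_le_mul_dist [Nonempty X'] (x₀ : X) {M : ℝ} (hM0 : 0 ≤ M)
    (hM : ∀ γ ≠ 1, dist x₀ (a γ x₀) ≤ 4 * N * ℓ →
      translationLength (b γ) ≤ M * translationLength (a γ)) (γ : G) {p : X} (hp : p ∈ V) :
    translationLength (b γ) ≤ M * dist p (a γ p) := by
  have : Nonempty X := ⟨x₀⟩
  have key : ∀ n : ℕ, ∀ γ, ∀ p ∈ V, dist p (a γ p) < n * ε →
      translationLength (b γ) ≤ M * dist p (a γ p) := by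
    intro n
    induction n with
    | zero =>
      intro γ p _ hg
      rw [Nat.cast_zero, zero_mul] at hg
      exact absurd hg dist_nonneg.not_gt
    | succ n ih =>
      intro γ p hp hlt
      obtain ⟨m, c, hc⟩ := h.exists_chain p hp _ (h.apply_mem γ p hp)
      rcases Nat.lt_or_ge (2 * N) m with hm | hm
      · obtain ⟨i, j, k, hij, hjk, hkm, ⟨α, hα⟩, η, hη⟩ := h.exists_three_same_orbit hc hm
        set q := c i
        have hq : q ∈ V := hc.mem i (by omega)
        have hA := hc.le_dist hij (by omega)
        have hB := hc.le_dist hjk (by omega)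
        have hC := hc.le_dist hkm le_rfl
        have e1 := hc.dist_add m le_rfl k hkm.le
        have e2 := hc.dist_add k hkm.le j hjk.le
        have e3 := hc.dist_add j (by omega) i hij.le
        rw [hc.apply_last] at e1 hC
        let g : Fin 3 → G := ![α, α⁻¹ * η, η⁻¹ * γ]
        let r : Fin 3 → ℝ := ![dist q (c j), dist (c j) (c k), dist (c k) (a γ p) + dist p q]
        have hinv : ∀ σ τ : G, dist q (a (σ⁻¹ * τ) q) = dist (a σ q) (a τ q) := fun σ τ => by
          rw [← (a σ).dist_eq, ← IsometryEquiv.mul_apply (a σ), ← map_mul, mul_inv_cancel_left]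
        have hγq : dist (a γ p) (a γ q) = dist p q := (a γ).dist_eq _ _
        have hr : ∀ t, dist q (a (g t) q) ≤ r t := by
          intro t
          fin_cases t
          · exact (congrArg (dist q) hα).le
          · change dist q (a (α⁻¹ * η) q) ≤ dist (c j) (c k)
            rw [hinv, hα, hη]
          · change dist q (a (η⁻¹ * γ) q) ≤ dist (c k) (a γ p) + dist p q
            rw [hinv, hη, ← hγq]
            exact dist_triangle _ _ _
        have hn0 := dist_nonneg (x := p) (y := q)
        have hsum : r 0 + r 1 + r 2 = dist p (a γ p) := by
          change dist q (c j) + dist (c j) (c k) + (dist (c k) (a γ p) + dist p q) = _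
          linarith
        have hrε : ∀ t, ε ≤ r t := by
          intro t
          fin_cases t
          · exact hA
          · exact hB
          · change ε ≤ dist (c k) (a γ p) + dist p q
            linarith
        have h0 := hrε 0
        have h1 := hrε 1
        have h2 := hrε 2
        have hε := h.eps_pos
        push_cast at hlt
        have htwo : ∀ s t, s ≠ t → r s + r t < n * ε := by
          intro s t hst
          fin_cases s <;> fin_cases t <;> first | exact absurd rfl hst | skip
          all_goals simp only [Fin.zero_eta, Fin.mk_one, Fin.reduceFinMk]; linarith
        have hone : ∀ t, r t < n * ε := by
          intro t
          fin_cases t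
          · change r 0 < n * ε
            linarith [htwo 0 1 (by decide)]
          · change r 1 < n * ε
            linarith [htwo 0 1 (by decide)]
          · change r 2 < n * ε
            linarith [htwo 0 2 (by decide)]
        obtain ⟨y, hy⟩ := hX'.exists_forall_dist_le Finset.univ (fun t => b (g t))
          (fun t => M * r t) (fun t _ => (ih (g t) q hq ((hr t).trans_lt (hone t))).trans
            (mul_le_mul_of_nonneg_left (hr t) hM0)) (fun s _ t _ hst => by
            have hd : dist q (a (g s * g t) q) ≤ r s + r t := by
              have h1 := dist_triangle q (a (g s) q) (a (g s * g t) q)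
              rw [map_mul, IsometryEquiv.mul_apply, (a (g s)).dist_eq] at h1
              rw [map_mul, IsometryEquiv.mul_apply]
              linarith [hr s, hr t]
            have := ih (g s * g t) q hq (hd.trans_lt (htwo s t hst))
            rw [map_mul] at this
            rw [← mul_add]
            exact this.trans (mul_le_mul_of_nonneg_left hd hM0))
        have hγ : γ = g 0 * (g 1 * g 2) := by
          change γ = α * (α⁻¹ * η * (η⁻¹ * γ))
          group
        refine (translationLength_le _ y).trans ?_
        have y0 := hy 0 (Finset.mem_univ _)
        have y1 := hy 1 (Finset.mem_univ _)
        have y2 := hy 2 (Finset.mem_univ _)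
        have hbγ : b γ y = b (g 0) (b (g 1) (b (g 2) y)) := by
          rw [hγ, map_mul, map_mul]
          rfl
        have t1 := dist_triangle4 y (b (g 0) y) (b (g 0) (b (g 1) y)) (b γ y)
        rw [hbγ, (b (g 0)).dist_eq, (b (g 0)).dist_eq, (b (g 1)).dist_eq, ← hbγ] at t1
        rw [← hsum, mul_add, mul_add]
        linarith
      · by_cases hγ : γ = 1
        · rw [hγ, map_one, translationLength_one]
          exact mul_nonneg hM0 dist_nonneg
        have hd : dist p (a γ p) ≤ 2 * N * ℓ := by
          refine hc.dist_le.trans (mul_le_mul_of_nonneg_right ?_ h.length_nonneg)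
          exact_mod_cast hm
        obtain ⟨g, hg⟩ := h.exists_conj_dist_le x₀ hp hd
        have := hM (g * γ * g⁻¹) (by simpa using hγ) hg
        rw [map_mul, map_mul, map_inv, translationLength_conj, map_mul, map_mul, map_inv,
          translationLength_conj] at this
        exact this.trans (mul_le_mul_of_nonneg_left (translationLength_le _ _) hM0)
  obtain ⟨n, hn⟩ := exists_nat_gt (dist p (a γ p) / ε)
  rw [div_lt_iff₀ h.eps_pos] at hn
  exact key n γ p hp hn

theorem translationLength_le_mul [Nonempty X'] (x₀ : X) {M : ℝ} (hM0 : 0 ≤ M)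
    (hM : ∀ γ ≠ 1, dist x₀ (a γ x₀) ≤ 4 * N * ℓ →
      translationLength (b γ) ≤ M * translationLength (a γ)) (γ : G) :
    translationLength (b γ) ≤ M * translationLength (a γ) := by
  have : Nonempty X := ⟨x₀⟩
  obtain ⟨p, hp, -⟩ := h.exists_near x₀
  obtain ⟨m, hm⟩ := h.isRealTree.exists_dist_eq_translationLength (a γ)
  -- compare the translation lengths of the powers of `γ`
  refine le_of_forall_nat_mul_le (c := M * (2 * dist p m)) fun n => ?_
  have h1 : n * translationLength (b γ) ≤ translationLength (b (γ ^ n)) := by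
    rw [map_pow]
    exact le_ciInf fun y => hX'.nat_mul_translationLength_le _ y n
  have h2 := h.translationLength_le_mul_dist hX' x₀ hM0 hM (γ ^ n) hp
  have h3 := dist_pow_apply_le_of_base (a γ) p m n
  rw [hm, ← map_pow] at h3
  have h4 := mul_le_mul_of_nonneg_left h3 hM0
  linarith

/-- If `λ(b γ) ≤ M λ(a γ)` for all `γ`, then the growth of `b` is at most `M (1 + 2 D / L)` for
every `L > 0`, where `D` is the codiameter of `a`. Some point `y` of `X'` is moved by at most
`M d(x₀, a γ x₀)` for all the finitely many `γ` with `d(x₀, a γ x₀) ≤ L + 2 D`, and every `γ` is a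
product of such elements, obtained by cutting the geodesic from `x₀` to `a γ x₀` into pieces of
length `L`. -/
theorem exists_growth_bound (x₀ : X) (x₀' : X') {M : ℝ} (hM0 : 0 ≤ M)
    (hM : ∀ γ, translationLength (b γ) ≤ M * translationLength (a γ)) {L : ℝ} (hL : 0 < L) :
    ∃ t', 0 ≤ t' ∧ ∀ γ, dist x₀' (b γ x₀') ≤
      M * (1 + 2 * ((N + 1) * ℓ) / L) * dist x₀ (a γ x₀) + t' := by
  have : Nonempty X := ⟨x₀⟩
  have : Nonempty X' := ⟨x₀'⟩
  set D := (N + 1) * ℓ with hD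
  have hD0 : 0 ≤ D := mul_nonneg (by positivity) h.length_nonneg
  have hfin := h.finite_dist_le x₀ (L + 2 * D)
  obtain ⟨y, hy⟩ := hX'.exists_forall_dist_le hfin.toFinset b (fun γ => M * dist x₀ (a γ x₀))
    (fun γ _ => (hM γ).trans (mul_le_mul_of_nonneg_left (translationLength_le _ _) hM0))
    (fun γ _ δ _ _ => by
      rw [← map_mul, ← mul_add]
      refine (hM _).trans (mul_le_mul_of_nonneg_left ((translationLength_le _ x₀).trans ?_) hM0)
      rw [map_mul, IsometryEquiv.mul_apply, ← (a γ).dist_eq x₀ (a δ x₀)]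
      exact dist_triangle _ _ _)
  have hshort : ∀ γ, dist x₀ (a γ x₀) ≤ L + 2 * D → dist y (b γ y) ≤ M * (L + 2 * D) := fun γ hγ =>
    (hy γ (hfin.mem_toFinset.2 hγ)).trans (mul_le_mul_of_nonneg_left hγ hM0)
  have key : ∀ n : ℕ, ∀ γ, dist x₀ (a γ x₀) ≤ n * L + D →
      dist y (b γ y) ≤ (n + 1) * (M * (L + 2 * D)) := by
    intro n
    induction n with
    | zero =>
      intro γ hγ
      have := hshort γ (by rw [Nat.cast_zero] at hγ; linarith)
      simpa using this
    | succ n ih =>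
      intro γ hγ
      push_cast at hγ ⊢
      -- a point `z` of the geodesic from `x₀` to `γ x₀`, at distance at most `n L` of `x₀`
      obtain ⟨z, hz1, hz2⟩ : ∃ z, dist x₀ z ≤ n * L ∧ dist z (a γ x₀) ≤ L + D := by
        have hnL : 0 ≤ n * L := by positivity
        rcases le_total (n * L) (dist x₀ (a γ x₀)) with hle | hle
        · obtain ⟨z, hz1, hz2⟩ := h.isRealTree.exists_dist_eq x₀ (a γ x₀) hnL hle
          exact ⟨z, hz1.le, by linarith⟩
        · exact ⟨a γ x₀, hle, by rw [dist_self]; linarith⟩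
      obtain ⟨g, hg⟩ := h.exists_dist_apply_le_of_point z x₀
      rw [← hD] at hg
      have h1 := ih g (by linarith [dist_triangle x₀ z (a g x₀)])
      have h2 := hshort (g⁻¹ * γ) (by
        rw [← (a g).dist_eq, ← IsometryEquiv.mul_apply (a g), ← map_mul, mul_inv_cancel_left]
        have := dist_triangle (a g x₀) z (a γ x₀)
        rw [dist_comm (a g x₀) z] at this
        linarith)
      rw [← (b g).dist_eq, ← IsometryEquiv.mul_apply (b g), ← map_mul, mul_inv_cancel_left] at h2
      linarith [dist_triangle y (b g y) (b γ y)]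
  refine ⟨2 * (M * (L + 2 * D)) + 2 * dist x₀' y, by positivity, fun γ => ?_⟩
  have h1 : dist x₀ (a γ x₀) ≤ (⌈dist x₀ (a γ x₀) / L⌉₊ : ℝ) * L + D := by
    have := Nat.le_ceil (dist x₀ (a γ x₀) / L)
    rw [div_le_iff₀ hL] at this
    linarith
  have h2 := key _ γ h1
  have h3 : (⌈dist x₀ (a γ x₀) / L⌉₊ : ℝ) < dist x₀ (a γ x₀) / L + 1 :=
    Nat.ceil_lt_add_one (by positivity)
  have h4 : ((⌈dist x₀ (a γ x₀) / L⌉₊ : ℝ) + 1) * (M * (L + 2 * D)) ≤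
      (dist x₀ (a γ x₀) / L + 2) * (M * (L + 2 * D)) :=
    mul_le_mul_of_nonneg_right (by linarith) (by positivity)
  have h5 : (dist x₀ (a γ x₀) / L + 2) * (M * (L + 2 * D)) =
      M * (1 + 2 * D / L) * dist x₀ (a γ x₀) + 2 * (M * (L + 2 * D)) := by
    field_simp
  have h6 := dist_triangle4 x₀' y (b γ y) (b γ x₀')
  rw [(b γ).dist_eq, dist_comm y x₀'] at h6
  linarith

/-- Every linear bound on the growth of `b` with respect to that of `a` bounds the ratios of
translation lengths. -/
theorem translationLength_le_mul_of_growth (x₀ : X) (x₀' : X') {t t' : ℝ} (ht : 0 ≤ t)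
    (hg : ∀ γ, dist x₀' (b γ x₀') ≤ t * dist x₀ (a γ x₀) + t') (γ : G) :
    translationLength (b γ) ≤ t * translationLength (a γ) := by
  have : Nonempty X := ⟨x₀⟩
  obtain ⟨m, hm⟩ := h.isRealTree.exists_dist_eq_translationLength (a γ)
  refine le_of_forall_nat_mul_le (c := t * (2 * dist x₀ m) + t') fun n => ?_
  have h1 := hX'.nat_mul_translationLength_le (b γ) x₀' n
  have h2 := hg (γ ^ n)
  have h3 := dist_pow_apply_le_of_base (a γ) x₀ m n
  rw [hm, ← map_pow] at h3
  rw [← map_pow] at h1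
  have h4 := mul_le_mul_of_nonneg_left h3 ht
  linarith

/-- If `d(x₀', b γ x₀') ≤ d(x₀, a γ x₀) - R` for all but finitely many `γ`, for every `R > 0`, then
`λ(b γ) < λ(a γ)` for all `γ ≠ 1`. -/
theorem translationLength_lt_of_admissible (x₀ : X) (x₀' : X')
    (hadm : ∀ R : ℝ, 0 < R → ∀ᶠ γ in Filter.cofinite,
      dist x₀' (b γ x₀') ≤ dist x₀ (a γ x₀) - R) {γ : G} (hγ : γ ≠ 1) :
    translationLength (b γ) < translationLength (a γ) := by
  have : Nonempty X := ⟨x₀⟩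
  by_contra! hle
  obtain ⟨m, hm⟩ := h.isRealTree.exists_dist_eq_translationLength (a γ)
  have hpos := h.translationLength_pos hγ
  have hinj : Function.Injective fun n : ℕ => γ ^ n := by
    refine injective_pow_iff_not_isOfFinOrder.2 fun hfin => ?_
    obtain ⟨n, hn, h1⟩ := isOfFinOrder_iff_pow_eq_one.1 hfin
    have h2 := h.isRealTree.nat_mul_translationLength_le (a γ) x₀ n
    rw [← map_pow, h1, map_one, IsometryEquiv.coe_one, id, dist_self] at h2
    have : 0 < (n : ℝ) * translationLength (a γ) := by positivity
    linarith
  have hR : 0 < 2 * dist x₀ m + 1 := by positivity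
  obtain ⟨n, hn⟩ := (hinj.tendsto_cofinite.eventually (hadm _ hR)).exists
  have h1 := hX'.nat_mul_translationLength_le (b γ) x₀' n
  have h2 := dist_pow_apply_le_of_base (a γ) x₀ m n
  rw [hm, ← map_pow] at h2
  rw [← map_pow] at h1
  have h3 : (n : ℝ) * translationLength (a γ) ≤ n * translationLength (b γ) := by gcongr
  linarith

end Representation

end IsFreeCocompact

/-! ### The growth constant -/

namespace IsFreeCocompact

variable {G X X' : Type*} [Group G] [MetricSpace X] [MetricSpace X'] {a : G →* (X ≃ᵢ X)}
  {b : G →* (X' ≃ᵢ X')} {V : Set X} {N : ℕ} {ε ℓ : ℝ}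

/-- The growth constant is at most any `M` bounding the ratios of translation lengths: let
`L → ∞` in `exists_growth_bound`. -/
theorem sInf_growth_le (h : IsFreeCocompact a V N ε ℓ) (hX' : IsRealTree X') (x₀ : X) (x₀' : X')
    {M : ℝ} (hM0 : 0 ≤ M) (hM : ∀ γ, translationLength (b γ) ≤ M * translationLength (a γ)) :
    sInf {t | 0 ≤ t ∧ ∃ t' : ℝ, 0 ≤ t' ∧ ∀ γ,
      dist x₀' (b γ x₀') ≤ t * dist x₀ (a γ x₀) + t'} ≤ M := by
  have : Nonempty X := ⟨x₀⟩
  refine le_of_forall_pos_le_add fun δ hδ => ?_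
  have hD : 0 ≤ (N + 1) * ℓ := mul_nonneg (by positivity) h.length_nonneg
  set D := (N + 1) * ℓ with hDdef
  have hL : 0 < (2 * M * D + 1) / δ := by positivity
  obtain ⟨t', ht', hg⟩ := h.exists_growth_bound hX' x₀ x₀' hM0 hM hL
  rw [← hDdef] at hg
  have hmem : M * (1 + 2 * D / ((2 * M * D + 1) / δ)) ∈ {t | 0 ≤ t ∧ ∃ t' : ℝ, 0 ≤ t' ∧ ∀ γ,
      dist x₀' (b γ x₀') ≤ t * dist x₀ (a γ x₀) + t'} := ⟨by positivity, t', ht', hg⟩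
  refine (csInf_le ⟨0, fun t ht => ht.1⟩ hmem).trans ?_
  have h1 : M * (1 + 2 * D / ((2 * M * D + 1) / δ)) = M + 2 * M * D / (2 * M * D + 1) * δ := by
    field_simp
  have h2 : 2 * M * D / (2 * M * D + 1) ≤ 1 := div_le_one_of_le₀ (by linarith) (by positivity)
  rw [h1]
  linarith [mul_le_mul_of_nonneg_right h2 hδ.le]

end IsFreeCocompact

theorem mainTheorem5 {X X' : Type*} [MetricSpace X] [MetricSpace X']
    (T : SimplicialRTree X) (T' : SimplicialRTree X')
    (hT : T.ValenceGETwo) (hT' : T'.ValenceGETwo) (hfin : T.IsLocallyFinite)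
    (Γ₀ : Subgroup T.Isom)
    (hdisc : DiscreteTopology Γ₀)
    (htf : ∀ γ : Γ₀, γ ≠ 1 → ¬ IsOfFinOrder γ)
    (hquotV : (T.quotientVerts Γ₀).Finite) (hquotE : (T.quotientEdges Γ₀).Finite)
    (x₀ : X) (x₀' : X') :
    (∀ γ : Γ₀, γ ≠ 1 → 0 < translationLength ((γ : T.Isom) : X ≃ᵢ X)) ∧
    (SimplicialRTree.shortElements Γ₀ x₀).Finite ∧
    ∀ ρ : Γ₀ →* T'.Isom,
      (SimplicialRTree.growthSet Γ₀ ρ x₀ x₀').Nonempty ∧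
      IsLUB (SimplicialRTree.lengthRatio Γ₀ ρ '' {γ | γ ≠ 1})
        (SimplicialRTree.growthConst Γ₀ ρ x₀ x₀') ∧
      IsGreatest (SimplicialRTree.lengthRatio Γ₀ ρ '' SimplicialRTree.shortElements Γ₀ x₀)
        (SimplicialRTree.growthConst Γ₀ ρ x₀ x₀') ∧
      (SimplicialRTree.Admissible Γ₀ ρ x₀ x₀' ↔
        SimplicialRTree.growthConst Γ₀ ρ x₀ x₀' < 1) := by
  have : Nonempty X := ⟨x₀⟩
  have : Nonempty X' := ⟨x₀'⟩
  obtain ⟨ε, h⟩ := T.isFreeCocompact hT hfin Γ₀ hdisc htf hquotV hquotE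
  have hX' := T'.isRealTree
  set a := T.Isom.subtype.comp Γ₀.subtype
  have hpos : ∀ γ : Γ₀, γ ≠ 1 → 0 < translationLength (a γ) := fun γ hγ =>
    h.translationLength_pos hγ
  have hF : (SimplicialRTree.shortElements Γ₀ x₀).Finite :=
    (h.finite_dist_le x₀ _).subset fun γ hγ => hγ.2
  have hFne : (SimplicialRTree.shortElements Γ₀ x₀).Nonempty := by
    obtain ⟨γ, hγ1, hγ2⟩ := h.exists_ne_one_dist_le (T.exists_ne_one hT Γ₀ hquotV) x₀
    exact ⟨γ, hγ1, hγ2⟩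
  refine ⟨hpos, hF, fun ρ => ?_⟩
  let b : Γ₀ →* (X' ≃ᵢ X') := T'.Isom.subtype.comp ρ
  -- `M` is the maximum of the ratios over the short elements, attained at `γ₀`
  obtain ⟨γ₀, hγ₀, hmax⟩ := Set.exists_max_image _ (SimplicialRTree.lengthRatio Γ₀ ρ) hF hFne
  set M := SimplicialRTree.lengthRatio Γ₀ ρ γ₀
  have hM0 : 0 ≤ M := div_nonneg (translationLength_nonneg _) (translationLength_nonneg _)
  have hM : ∀ γ, translationLength (b γ) ≤ M * translationLength (a γ) :=
    h.translationLength_le_mul hX' x₀ hM0 fun γ hγ1 hγ2 =>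
      (div_le_iff₀ (hpos γ hγ1)).1 (hmax γ ⟨hγ1, hγ2⟩)
  have hne : (SimplicialRTree.growthSet Γ₀ ρ x₀ x₀').Nonempty := by
    obtain ⟨t', ht', hg⟩ := h.exists_growth_bound hX' x₀ x₀' hM0 hM one_pos
    have := h.length_nonneg
    exact ⟨_, by positivity, t', ht', hg⟩
  have hupper : ∀ γ : Γ₀, γ ≠ 1 → SimplicialRTree.lengthRatio Γ₀ ρ γ ≤
      SimplicialRTree.growthConst Γ₀ ρ x₀ x₀' := fun γ hγ => by
    refine le_csInf hne fun t ht => (div_le_iff₀ (hpos γ hγ)).2 ?_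
    obtain ⟨ht0, t', -, hg⟩ := ht
    exact h.translationLength_le_mul_of_growth (b := b) hX' x₀ x₀' ht0 hg γ
  have hC : SimplicialRTree.growthConst Γ₀ ρ x₀ x₀' = M :=
    le_antisymm (h.sInf_growth_le (b := b) hX' x₀ x₀' hM0 hM) (hupper γ₀ hγ₀.1)
  refine ⟨hne, ⟨?_, fun t ht => ?_⟩, ⟨⟨γ₀, hγ₀, hC.symm⟩, ?_⟩, fun hadm => ?_, fun hlt => ?_⟩
  · rintro _ ⟨γ, hγ, rfl⟩
    exact hupper γ hγ
  · rw [hC]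
    exact ht ⟨γ₀, hγ₀.1, rfl⟩
  · rintro _ ⟨γ, hγ, rfl⟩
    exact hupper γ hγ.1
  · rw [hC]
    exact (div_lt_one (hpos γ₀ hγ₀.1)).2
      (h.translationLength_lt_of_admissible (b := b) hX' x₀ x₀' hadm hγ₀.1)
  · intro R _
    obtain ⟨t, ⟨-, t', -, hg⟩, ht1⟩ := exists_lt_of_csInf_lt hne hlt
    -- the inequality holds as soon as `(1 - t) d(x₀, γ x₀) ≥ R + t'`
    refine (h.finite_dist_le x₀ ((R + t') / (1 - t))).subset fun γ hγ => ?_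
    by_contra hlarge
    refine hγ ((hg γ).trans ?_)
    have h1 : (R + t') / (1 - t) < dist x₀ (a γ x₀) := not_le.1 hlarge
    rw [div_lt_iff₀ (by linarith)] at h1
    change t * dist x₀ (a γ x₀) + t' ≤ dist x₀ (a γ x₀) - R
    linarith
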